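/- For $s>1$ let $*$ denote the Beurling class $(s)$ or the Roumieu class $\{s\}$. For $\varphi\in C_c^\infty(\mathbb R^n)$ put $\|\varphi\|_{s,h}=\sup_{x,\alpha}|D^\alpha\varphi(x)|/(h^{|\alpha|}(|\alpha|!)^s)$. For $U\subset\mathbb R^n$ open let $\mathcal D^{(s)}(U)$ (resp. $\mathcal D^{\{s\}}(U)$) be the space of $\varphi\in C^\infty_c(U)$ with $\|\varphi\|_{s,h}<\infty$ for all (resp. for some) $h>0$, with its usual locally convex limit topology. Let $\mathcal Db^{*}(U)$ be its continuous dual (ultradistributions of class $*$ on $U$), and let $$\mathcal Db^{*t}(U)=\Gamma(\mathbb R^n;\mathcal Db^{*})/\Gamma_{\mathbb R^n\setminus U}(\mathbb R^n;\mathcal Db^{*})\subset\mathcal Db^*(U)$$ be the presheaf of tempered ultradistributions, where $\Gamma_{\mathbb R^n\setminus U}$ denotes the sections supported in $\mathbb R^n\setminus U$. A function $f\in L_{loc}(U)$ is said to be in $\mathcal Db^{*t}(U)$ if the form $\varphi\mapsto\int_U f\varphi\,dx$ on $\mathcal D^*(U)$ is in the image of $\mathcal Db^{*t}(U)\hookrightarrow\mathcal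 Db^*(U)$. The subanalytic site $\mathbb R^n_{sa}$ has as open sets the relatively compact subanalytic open subsets of $\mathbb R^n$. A covering of such a $U$ is a set $S$ of such open subsets of $U$ with the property that for every compact $K\subset\mathbb R^n$ there is a finite $S_0\subset S$ with $K\cap\bigcup_{V\in S_0}V=K\cap U$. (1) Let $l\ge 1$ be an integer, $U_1=\{(x,y)\in\mathbb R^2:\ y>x^{2l+1}\}$ and $U_2=\{(x,y)\in\mathbb R^2:\ y<0\}$. Define $u_1$ on $U_1$ by $u_1(x,y)=\exp\bigl(\tfrac{1}{y-x^{2l+1}}\bigr)$ if $y>0$ and $u_1(x,y)=0$ if $y\le 0$, and let $u_2=0$ on $U_2$. Then $u_1\in\mathcal Db^{(2)t}(U_1)$, $u_2\in\mathcal Db^{(2)t}(U_2)$, and $u_1=u_2$ on $U_1\cap U_2$, both as functions and as sections of $\mathcal Db^{(2)t}(U_1\cap U_2)$. The function $u$ on $U_1\cup U_2$ with $u|_{U_1}=u_1$ and $u|_{U_2}=u_2$ is in $L_{loc}(U_1\cup U_2)$, but $u\notin\mathcal Db^{(2)t}(U_1\cup U_2)$. Moreover, no section of $\mathcal Db^{(2)t}(U_1\cup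 U_2)$ restricts to $u_1$ on $U_1$ and to $u_2$ on $U_2$. (2) For every $s>1$ and $*=(s)$ or $*=\{s\}$, the presheaf $\mathcal Db^{*t}$ of tempered ultradistributions on $\mathbb R^2$ is not a sheaf on the subanalytic site $\mathbb R^2_{sa}$. -/

import Mathlib

open Set MeasureTheory TopologicalSpace CategoryTheory
open scoped ContDiff Manifold

noncomputable section

namespace TemperedUltra

/-- The space `ℝⁿ`. -/
abbrev Rn (n : ℕ) : Type := EuclideanSpace ℝ (Fin n)

/-! ### Ultradifferentiable functions and ultradistributions on open subsets of `ℝⁿ` -/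

/-- The symbol `*`: the Beurling class `(s)` or the Roumieu class `{s}`. -/
inductive GevreyClass : Type
  | beurling (s : ℝ)
  | roumieu (s : ℝ)

/-- The order `s` of the class `(s)` or `{s}`. -/
def GevreyClass.order : GevreyClass → ℝ
  | .beurling s => s
  | .roumieu s => s

/-- `HasGevreyBound s h M φ` says that the norm
`‖φ‖_{s,h} = sup_{x, α} |D^α φ (x)| / (h^|α| (|α|!)^s)` is at most `M`.
The multi-indices `α` of length `k` are listed through the words `j : Fin k → Fin n`: the value
of the `k`-th derivative at the basis vectors `e_{j 0}, …, e_{j (k-1)}` is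
`∂_{j 0} ⋯ ∂_{j (k-1)} φ (x)`. -/
def HasGevreyBound {n : ℕ} (s h M : ℝ) (φ : Rn n → ℂ) : Prop :=
  ∀ (k : ℕ) (j : Fin k → Fin n) (x : Rn n),
    ‖iteratedFDeriv ℝ k φ x (fun i => EuclideanSpace.single (j i) (1 : ℝ))‖
      ≤ M * (h ^ k * (k.factorial : ℝ) ^ s)

/-- The growth condition of the class `*`: all `‖φ‖_{s,h}`, `h > 0`, are finite (Beurling),
respectively some `‖φ‖_{s,h}` is finite (Roumieu). -/
def IsGevrey {n : ℕ} (c : GevreyClass) (φ : Rn n → ℂ) : Prop :=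
  match c with
  | .beurling s => ∀ h : ℝ, 0 < h → ∃ M : ℝ, HasGevreyBound s h M φ
  | .roumieu s => ∃ h : ℝ, 0 < h ∧ ∃ M : ℝ, HasGevreyBound s h M φ

theorem HasGevreyBound.nonneg {n : ℕ} {s h M : ℝ} {φ : Rn n → ℂ}
    (H : HasGevreyBound s h M φ) : 0 ≤ M := by
  have := (norm_nonneg _).trans (H 0 Fin.elim0 0)
  simpa using this

theorem HasGevreyBound.mono {n : ℕ} {s h h' M : ℝ} {φ : Rn n → ℂ}
    (H : HasGevreyBound s h M φ) (hh : 0 < h) (hle : h ≤ h') : HasGevreyBound s h' M φ := by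
  intro k j x
  refine (H k j x).trans ?_
  have := H.nonneg
  gcongr

theorem HasGevreyBound.add {n : ℕ} {s h M M' : ℝ} {φ ψ : Rn n → ℂ}
    (hφ : ContDiff ℝ ∞ φ) (hψ : ContDiff ℝ ∞ ψ)
    (H : HasGevreyBound s h M φ) (H' : HasGevreyBound s h M' ψ) :
    HasGevreyBound s h (M + M') (φ + ψ) := by
  intro k j x
  have hk : ((k : ℕ∞) : WithTop ℕ∞) ≤ ∞ := by exact_mod_cast le_top
  rw [iteratedFDeriv_add_apply (hφ.of_le hk).contDiffAt (hψ.of_le hk).contDiffAt]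
  rw [add_apply, add_mul]
  exact (norm_add_le _ _).trans (add_le_add (H k j x) (H' k j x))

theorem HasGevreyBound.smul {n : ℕ} {s h M : ℝ} {φ : Rn n → ℂ} (a : ℂ)
    (hφ : ContDiff ℝ ∞ φ) (H : HasGevreyBound s h M φ) :
    HasGevreyBound s h (‖a‖ * M) (a • φ) := by
  intro k j x
  have hk : ((k : ℕ∞) : WithTop ℕ∞) ≤ ∞ := by exact_mod_cast le_top
  rw [iteratedFDeriv_const_smul_apply (hφ.of_le hk).contDiffAt]
  rw [smul_apply, norm_smul, mul_assoc]
  exact mul_le_mul_of_nonneg_left (H k j x) (norm_nonneg _)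

theorem HasGevreyBound.zero {n : ℕ} (s h : ℝ) : HasGevreyBound s h 0 (0 : Rn n → ℂ) := by
  intro k j x
  have : iteratedFDeriv ℝ k (0 : Rn n → ℂ) x = 0 := by
    have := iteratedFDeriv_fun_zero (𝕜 := ℝ) (E := Rn n) (F := ℂ) (n := k)
    exact congrFun this x
  simp [this]

/-- The space `𝒟^*(U)` of compactly supported ultradifferentiable functions of class `*` with
support in the open set `U` (extended by zero to `ℝⁿ`). -/
def testSpace {n : ℕ} (c : GevreyClass) (U : Opens (Rn n)) : Submodule ℂ (Rn n → ℂ) where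
  carrier := {φ | ContDiff ℝ ∞ φ ∧ HasCompactSupport φ ∧ tsupport φ ⊆ U ∧ IsGevrey c φ}
  add_mem' := by
    rintro φ ψ ⟨h1, h2, h3, h4⟩ ⟨k1, k2, k3, k4⟩
    refine ⟨h1.add k1, h2.add k2, (tsupport_add φ ψ).trans (union_subset h3 k3), ?_⟩
    cases c with
    | beurling s =>
      intro h hh
      obtain ⟨M, hM⟩ := h4 h hh
      obtain ⟨M', hM'⟩ := k4 h hh
      exact ⟨_, hM.add h1 k1 hM'⟩
    | roumieu s =>
      obtain ⟨h, hh, M, hM⟩ := h4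
      obtain ⟨h', hh', M', hM'⟩ := k4
      exact ⟨max h h', lt_max_of_lt_left hh, _,
        (hM.mono hh (le_max_left _ _)).add h1 k1 (hM'.mono hh' (le_max_right _ _))⟩
  zero_mem' := by
    refine ⟨contDiff_zero_fun, HasCompactSupport.zero, by simp, ?_⟩
    cases c with
    | beurling s => exact fun h _ => ⟨0, HasGevreyBound.zero s h⟩
    | roumieu s => exact ⟨1, one_pos, 0, HasGevreyBound.zero s 1⟩
  smul_mem' := by
    rintro a φ ⟨h1, h2, h3, h4⟩
    have hsub : Function.support (a • φ) ⊆ Function.support φ :=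
      Function.support_const_smul_subset a φ
    refine ⟨contDiff_const.smul h1, h2.mono hsub, (closure_mono hsub).trans h3, ?_⟩
    cases c with
    | beurling s =>
      intro h hh
      obtain ⟨M, hM⟩ := h4 h hh
      exact ⟨_, hM.smul a h1⟩
    | roumieu s =>
      obtain ⟨h, hh, M, hM⟩ := h4
      exact ⟨h, hh, _, hM.smul a h1⟩

/-- `‖T φ‖ ≤ C ‖φ‖_{s,h}` for all `φ ∈ 𝒟^*(U)` with support in `K` (there is nothing to check
where `‖φ‖_{s,h} = ∞`). -/
def BoundedOn {n : ℕ} {c : GevreyClass} {U : Opens (Rn n)} (T : testSpace c U →ₗ[ℂ] ℂ)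
    (K : Set (Rn n)) (s h C : ℝ) : Prop :=
  ∀ φ : testSpace c U, tsupport (φ : Rn n → ℂ) ⊆ K →
    ∀ M : ℝ, HasGevreyBound s h M (φ : Rn n → ℂ) → ‖T φ‖ ≤ C * M

/-- Continuity of a linear form for the locally convex topology of
`𝒟^{(s)}(U) = lim→_K lim←_h 𝒟_K^{s,h}`, respectively `𝒟^{\{s\}}(U) = lim→_K lim→_h 𝒟_K^{s,h}`:
a linear form on a locally convex inductive limit is continuous if and only if it is continuous
on each step, and on a projective limit over `h` if and only if it is bounded by a multiple of one
of the norms. -/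
def IsContinuousForm {n : ℕ} {c : GevreyClass} {U : Opens (Rn n)}
    (T : testSpace c U →ₗ[ℂ] ℂ) : Prop :=
  ∀ K : Set (Rn n), IsCompact K → K ⊆ U →
    match c with
    | .beurling s => ∃ h : ℝ, 0 < h ∧ ∃ C : ℝ, BoundedOn T K s h C
    | .roumieu s => ∀ h : ℝ, 0 < h → ∃ C : ℝ, BoundedOn T K s h C

theorem BoundedOn.add {n : ℕ} {c : GevreyClass} {U : Opens (Rn n)}
    {T T' : testSpace c U →ₗ[ℂ] ℂ} {K : Set (Rn n)} {s h C C' : ℝ}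
    (H : BoundedOn T K s h C) (H' : BoundedOn T' K s h C') :
    BoundedOn (T + T') K s h (C + C') := by
  intro φ hφ M hM
  rw [LinearMap.add_apply, add_mul]
  exact (norm_add_le _ _).trans (add_le_add (H φ hφ M hM) (H' φ hφ M hM))

theorem BoundedOn.smul {n : ℕ} {c : GevreyClass} {U : Opens (Rn n)}
    {T : testSpace c U →ₗ[ℂ] ℂ} {K : Set (Rn n)} {s h C : ℝ} (a : ℂ)
    (H : BoundedOn T K s h C) : BoundedOn (a • T) K s h (‖a‖ * C) := by
  intro φ hφ M hM
  rw [LinearMap.smul_apply, norm_smul, mul_assoc]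
  exact mul_le_mul_of_nonneg_left (H φ hφ M hM) (norm_nonneg _)

theorem BoundedOn.anti {n : ℕ} {c : GevreyClass} {U : Opens (Rn n)}
    {T : testSpace c U →ₗ[ℂ] ℂ} {K : Set (Rn n)} {s h h' C : ℝ}
    (H : BoundedOn T K s h C) (hh' : 0 < h') (hle : h' ≤ h) : BoundedOn T K s h' C :=
  fun φ hφ M hM => H φ hφ M (hM.mono hh' hle)

/-- The space `𝒟b^*(U)` of ultradistributions of class `*` on `U`: the continuous dual of
`𝒟^*(U)` (on `ℝⁿ`, volume elements are identified with functions through `dx`). -/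
def ultradistributions {n : ℕ} (c : GevreyClass) (U : Opens (Rn n)) :
    Submodule ℂ (testSpace c U →ₗ[ℂ] ℂ) where
  carrier := {T | IsContinuousForm T}
  add_mem' := by
    intro T T' hT hT' K hK hKU
    have H := hT K hK hKU
    have H' := hT' K hK hKU
    cases c with
    | beurling s =>
      obtain ⟨h, hh, C, hC⟩ := H
      obtain ⟨h', hh', C', hC'⟩ := H'
      exact ⟨min h h', lt_min hh hh', _, (hC.anti (lt_min hh hh') (min_le_left _ _)).add
        (hC'.anti (lt_min hh hh') (min_le_right _ _))⟩
    | roumieu s =>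
      intro h hh
      obtain ⟨C, hC⟩ := H h hh
      obtain ⟨C', hC'⟩ := H' h hh
      exact ⟨_, hC.add hC'⟩
  zero_mem' := by
    intro K _ _
    have h0 : ∀ s h : ℝ, BoundedOn (0 : testSpace c U →ₗ[ℂ] ℂ) K s h 0 := by
      intro s h φ _ M _
      simp
    cases c with
    | beurling s => exact ⟨1, one_pos, 0, h0 s 1⟩
    | roumieu s => exact fun h _ => ⟨0, h0 s h⟩
  smul_mem' := by
    intro a T hT K hK hKU
    have H := hT K hK hKU
    cases c with
    | beurling s =>
      obtain ⟨h, hh, C, hC⟩ := H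
      exact ⟨h, hh, _, hC.smul a⟩
    | roumieu s =>
      intro h hh
      obtain ⟨C, hC⟩ := H h hh
      exact ⟨_, hC.smul a⟩

theorem testSpace_mono {n : ℕ} (c : GevreyClass) {V U : Opens (Rn n)} (h : V ≤ U) :
    testSpace c V ≤ testSpace c U :=
  fun _ hφ => ⟨hφ.1, hφ.2.1, hφ.2.2.1.trans h, hφ.2.2.2⟩

/-- Restriction `𝒟b^*(U) → 𝒟b^*(V)` for `V ⊆ U`: the transpose of the inclusion
`𝒟^*(V) ⊆ 𝒟^*(U)`. -/
def restrict {n : ℕ} (c : GevreyClass) {V U : Opens (Rn n)} (h : V ≤ U) :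
    ultradistributions c U →ₗ[ℂ] ultradistributions c V where
  toFun T := ⟨(T : testSpace c U →ₗ[ℂ] ℂ).comp (Submodule.inclusion (testSpace_mono c h)), by
    intro K hK hKV
    have H := T.2 K hK (hKV.trans h)
    cases c with
    | beurling s =>
      obtain ⟨r, hr, C, hC⟩ := H
      exact ⟨r, hr, C, fun φ hφ M hM =>
        hC (Submodule.inclusion (testSpace_mono _ h) φ) hφ M hM⟩
    | roumieu s =>
      intro r hr
      obtain ⟨C, hC⟩ := H r hr
      exact ⟨C, fun φ hφ M hM =>
        hC (Submodule.inclusion (testSpace_mono _ h) φ) hφ M hM⟩⟩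
  map_add' _ _ := rfl
  map_smul' _ _ := rfl

/-! ### Tempered ultradistributions -/

/-- `Γ_{X∖U}(X; 𝒟b^*)` for `X = ℝⁿ`: the global ultradistributions supported by `X ∖ U`, that is,
those whose restriction to `U` vanishes. -/
def supportedOff {n : ℕ} (c : GevreyClass) (U : Opens (Rn n)) :
    Submodule ℂ (ultradistributions c (⊤ : Opens (Rn n))) :=
  LinearMap.ker (restrict c (le_top : U ≤ ⊤))

/-- Tempered ultradistributions `𝒟b^{*t}(U) = Γ(X; 𝒟b^*) / Γ_{X∖U}(X; 𝒟b^*)`, `X = ℝⁿ`. -/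
abbrev Tempered {n : ℕ} (c : GevreyClass) (U : Opens (Rn n)) : Type :=
  ultradistributions c (⊤ : Opens (Rn n)) ⧸ supportedOff c U

theorem supportedOff_anti {n : ℕ} (c : GevreyClass) {V U : Opens (Rn n)} (h : V ≤ U) :
    supportedOff c U ≤ supportedOff c V := by
  intro T hT
  have hT' : restrict c (le_top : U ≤ ⊤) T = 0 := hT
  change restrict c h (restrict c (le_top : U ≤ ⊤) T) = 0
  rw [hT', map_zero]

/-- Restriction `𝒟b^{*t}(U) → 𝒟b^{*t}(V)` for `V ⊆ U`. -/
def temperedRestrict {n : ℕ} (c : GevreyClass) {V U : Opens (Rn n)} (h : V ≤ U) :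
    Tempered c U →ₗ[ℂ] Tempered c V :=
  Submodule.factor (supportedOff_anti c h)

/-- The presheaf `𝒟b^{*t}` of complex vector spaces. -/
def temperedPresheaf (n : ℕ) (c : GevreyClass) : (Opens (Rn n))ᵒᵖ ⥤ ModuleCat.{0} ℂ where
  obj U := ModuleCat.of ℂ (Tempered c U.unop)
  map f := ModuleCat.ofHom (temperedRestrict c (leOfHom f.unop))
  map_id U := by
    ext x
    rfl
  map_comp f g := by
    ext x
    rfl

/-- The canonical (injective) map `𝒟b^{*t}(U) → 𝒟b^*(U)`. -/
def Tempered.toUltradistribution {n : ℕ} {c : GevreyClass} {U : Opens (Rn n)} :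
    Tempered c U →ₗ[ℂ] ultradistributions c U :=
  (supportedOff c U).liftQ (restrict c (le_top : U ≤ ⊤)) le_rfl

theorem Tempered.toUltradistribution_injective {n : ℕ} {c : GevreyClass} {U : Opens (Rn n)} :
    Function.Injective (Tempered.toUltradistribution (c := c) (U := U)) := by
  rw [← LinearMap.ker_eq_bot]
  exact Submodule.ker_liftQ_eq_bot _ _ _ le_rfl

/-- The ultradistribution `T` on `U` is the locally integrable function `f` on `U`, that is,
`T φ = ∫_U f φ dx` for every test function `φ`. -/
def IsGivenBy {n : ℕ} {c : GevreyClass} {U : Opens (Rn n)} (T : ultradistributions c U)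
    (f : Rn n → ℂ) : Prop :=
  LocallyIntegrableOn f (U : Set (Rn n)) ∧
    ∀ φ : testSpace c U,
      (T : testSpace c U →ₗ[ℂ] ℂ) φ = ∫ x in (U : Set (Rn n)), f x * (φ : Rn n → ℂ) x

/-- The tempered ultradistribution `t` on `U` is the locally integrable function `f` on `U`. -/
def Tempered.IsGivenBy {n : ℕ} {c : GevreyClass} {U : Opens (Rn n)} (t : Tempered c U)
    (f : Rn n → ℂ) : Prop :=
  TemperedUltra.IsGivenBy (Tempered.toUltradistribution t) f

/-! ### The subanalytic site -/

/-- `Z` is semi-analytic at the point `x` of the real analytic manifold `M`: near `x` it is a finite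
union of finite intersections of sets `{f > 0}` or `{f = 0}` with `f` real analytic. The Boolean
`σ i j` says which of the two cases occurs. -/
def IsSemianalyticAt {E H M : Type} [NormedAddCommGroup E] [NormedSpace ℝ E] [TopologicalSpace H]
    (I : ModelWithCorners ℝ E H) [TopologicalSpace M] [ChartedSpace H M]
    (Z : Set M) (x : M) : Prop :=
  ∃ W : Set M, IsOpen W ∧ x ∈ W ∧
    ∃ (p q : ℕ) (f : Fin p → Fin q → M → ℝ) (σ : Fin p → Fin q → Bool),
      (∀ i j, ContMDiffOn I 𝓘(ℝ, ℝ) ω (f i j) W) ∧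
      Z ∩ W = {y | y ∈ W ∧ ∃ i, ∀ j, if σ i j = true then 0 < f i j y else f i j y = 0}

/-- `Z` is a semi-analytic subset of the real analytic manifold `M`. -/
def IsSemianalytic {E H M : Type} [NormedAddCommGroup E] [NormedSpace ℝ E] [TopologicalSpace H]
    (I : ModelWithCorners ℝ E H) [TopologicalSpace M] [ChartedSpace H M] (Z : Set M) : Prop :=
  ∀ x : M, IsSemianalyticAt I Z x

/-- `Z ⊆ ℝⁿ` is subanalytic: near every point of `ℝⁿ` it is the projection of a relatively compact
semi-analytic subset of `ℝⁿ × Y` for a real analytic manifold `Y` (Hausdorff and countable at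
infinity). -/
def IsSubanalytic {n : ℕ} (Z : Set (Rn n)) : Prop :=
  ∀ x : Rn n, ∃ W : Set (Rn n), IsOpen W ∧ x ∈ W ∧
    ∃ (m : ℕ) (Y : Type) (_ : TopologicalSpace Y) (_ : ChartedSpace (Rn m) Y)
      (_ : IsManifold (𝓡 m) ω Y) (_ : T2Space Y) (_ : SigmaCompactSpace Y) (A : Set (Rn n × Y)),
      IsCompact (closure A) ∧ IsSemianalytic ((𝓡 n).prod (𝓡 m)) A ∧ Prod.fst '' A = Z ∩ W

/-- The open sets of the subanalytic site: relatively compact subanalytic open sets. -/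
def IsSaOpen {n : ℕ} (U : Opens (Rn n)) : Prop :=
  IsCompact (closure (U : Set (Rn n))) ∧ IsSubanalytic (U : Set (Rn n))

/-- `S` is a covering of `U` in the subanalytic site: a set of open sets of the site contained in
`U` such that for every compact `K ⊆ ℝⁿ` there is a finite subset `S₀` of `S` with
`K ∩ ⋃_{V ∈ S₀} V = K ∩ U`. -/
def IsSaCovering {n : ℕ} (U : Opens (Rn n)) (S : Set (Opens (Rn n))) : Prop :=
  (∀ V ∈ S, IsSaOpen V ∧ V ≤ U) ∧
    ∀ K : Set (Rn n), IsCompact K → ∃ S₀ ⊆ S, S₀.Finite ∧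
      K ∩ (⋃ V ∈ S₀, (V : Set (Rn n))) = K ∩ (U : Set (Rn n))

/-- The presheaf `F` is a sheaf on the subanalytic site of `ℝⁿ`: for every covering `S` of an open
set `U` of the site, `F(U)` is mapped bijectively onto the families `(s_V)_{V ∈ S}` with
`s_V = s_{V'}` on `V ∩ V'`. -/
def IsSaSheaf {n : ℕ} (F : (Opens (Rn n))ᵒᵖ ⥤ ModuleCat.{0} ℂ) : Prop :=
  ∀ U : Opens (Rn n), IsSaOpen U → ∀ (S : Set (Opens (Rn n))) (hS : IsSaCovering U S)
    (s : ∀ V : S, F.obj (Opposite.op (V : Opens (Rn n)))),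
    (∀ V V' : S,
      F.map (homOfLE (inf_le_left : (V : Opens (Rn n)) ⊓ V' ≤ V)).op (s V) =
        F.map (homOfLE (inf_le_right : (V : Opens (Rn n)) ⊓ V' ≤ V')).op (s V')) →
    ∃! t : F.obj (Opposite.op U),
      ∀ V : S, F.map (homOfLE (hS.1 V V.2).2).op t = s V

/-! ### The two open sets and the two functions; `p 0 = x` and `p 1 = y` -/

/-- `U₁ = {y > x^{2l+1}}`. -/
def U₁ (l : ℕ) : Opens (Rn 2) where
  carrier := {p | p 0 ^ (2 * l + 1) < p 1}
  is_open' := isOpen_lt (by fun_prop) (by fun_prop)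

/-- `U₂ = {y < 0}`. -/
def U₂ : Opens (Rn 2) where
  carrier := {p | p 1 < 0}
  is_open' := isOpen_lt (by fun_prop) (by fun_prop)

/-- The function `u₁` (only its values on `U₁` matter). -/
def u₁ (l : ℕ) (p : Rn 2) : ℂ :=
  if 0 < p 1 then (Real.exp (1 / (p 1 - p 0 ^ (2 * l + 1))) : ℂ) else 0

/-- The function `u₂ = 0`. -/
def u₂ (_p : Rn 2) : ℂ := 0

end TemperedUltra

end

/-! Put m = 2l+1 and consider exp((y - x^m)^(-1/τ)) on U₁, cut off to y > 0 (`expFun`); u₁ is the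
case τ = 1.

Extension. A test function of class (τ+1) supported in U₁ is flat at the boundary: Taylor's formula
along the vertical segment of length t = y - x^m bounds it by t^k/k! times its k-th vertical
derivative, and a good choice of k compensates exp(t^(-1/τ)) (`norm_expFun_mul_le`). So integration
against `expFun` is dominated by a seminorm, and Hahn–Banach extends it to the plane
(`exists_extension_expFun`). On U₂ the function is 0, so it agrees there with the zero section.

Failure of gluing. For x near -ε the overlap of U₁ and U₂ is a strip of thickness about ε^m. A bump
of size ε near (-3ε/2, 0) splits inside that strip into a piece supported in U₁ and a piece
supported in U₂. The steep cutoff that splits it cancels in the sum, so the Gevrey norm of the sum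
only sees the scale ε and is at most exp(const · ε^(-1/ρ)) up to a factor. Here ρ = s - s', with s'
> 1 the order of the bump, and ρ can be taken as close to s - 1 as desired. A common extension T
would take on this bump the value of the integral over the first piece, which is at least about
ε^(2m) exp((3ε)^(-m/τ)). This contradicts continuity once τ < m(s - 1) (`not_exists_gluing`). Bumps
of order s' near 1 come from exp(-1/t^N) with N large and odd.

Part (1) takes τ = 1, s = 2. Part (2) takes m = 3 and τ = 2(s - 1): then s < τ + 1, which treats
both classes at once, and 2 < 3 gives the inequality. Intersecting with the unit disc makes the open
sets relatively compact. -/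

namespace TemperedUltra

open Filter Topology

/-! ### Gevrey bounds for the norms of iterated derivatives -/

/-- `f` satisfies the Gevrey bounds `‖D^k f‖ ≤ M A^k (k!)^s`. -/
def GevreyBounds {E F : Type*} [NormedAddCommGroup E] [NormedSpace ℝ E] [NormedAddCommGroup F]
    [NormedSpace ℝ F] (s A M : ℝ) (f : E → F) : Prop :=
  ∀ (k : ℕ) (x : E), ‖iteratedFDeriv ℝ k f x‖ ≤ M * (A ^ k * (k.factorial : ℝ) ^ s)

theorem natCast_le_infty (k : ℕ) : (k : WithTop ℕ∞) ≤ ∞ := by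
  exact_mod_cast (le_top : (k : ℕ∞) ≤ ⊤)

theorem factorial_rpow_mul_le {s : ℝ} (hs : 0 ≤ s) {i k : ℕ} (hik : i ≤ k) :
    (i.factorial : ℝ) ^ s * ((k - i).factorial : ℝ) ^ s ≤ (k.factorial : ℝ) ^ s := by
  rw [← Real.mul_rpow (by positivity) (by positivity)]
  refine Real.rpow_le_rpow (by positivity) ?_ hs
  have := Nat.factorial_mul_factorial_dvd_factorial hik
  exact_mod_cast Nat.le_of_dvd (Nat.factorial_pos k) this

section
variable {E F : Type*} [NormedAddCommGroup E] [NormedSpace ℝ E] [NormedAddCommGroup F]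
  [NormedSpace ℝ F]

/-- Leibniz's rule: the binomial theorem adds the radii, and the factorials cost nothing because i!
(k-i)! ≤ k!. -/
theorem GevreyBounds.mul {s A B M N : ℝ} (hs : 0 ≤ s) (hA : 0 ≤ A) (hB : 0 ≤ B)
    {f g : E → ℝ} (hf : ContDiff ℝ ∞ f) (hg : ContDiff ℝ ∞ g)
    (Hf : GevreyBounds s A M f) (Hg : GevreyBounds s B N g) :
    GevreyBounds s (A + B) (M * N) (fun x => f x * g x) := by
  intro k x
  have hM : 0 ≤ M := by have := (norm_nonneg _).trans (Hf 0 x); simpa using this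
  have hN : 0 ≤ N := by have := (norm_nonneg _).trans (Hg 0 x); simpa using this
  refine (norm_iteratedFDeriv_mul_le hf hg x (natCast_le_infty k)).trans ?_
  have h1 : M * N * ((A + B) ^ k * (k.factorial : ℝ) ^ s) =
      ∑ i ∈ Finset.range (k + 1),
        M * N * (k.factorial : ℝ) ^ s * (A ^ i * B ^ (k - i) * (k.choose i)) := by
    rw [← Finset.mul_sum, ← add_pow]; ring
  rw [h1]
  refine Finset.sum_le_sum fun i hi => ?_
  have hik : i ≤ k := Nat.lt_succ_iff.mp (Finset.mem_range.mp hi)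
  calc (k.choose i : ℝ) * ‖iteratedFDeriv ℝ i f x‖ * ‖iteratedFDeriv ℝ (k - i) g x‖
      ≤ (k.choose i : ℝ) * (M * (A ^ i * (i.factorial : ℝ) ^ s)) *
        (N * (B ^ (k - i) * ((k - i).factorial : ℝ) ^ s)) := by
        gcongr
        · exact Hf i x
        · exact Hg (k - i) x
    _ = (M * N * (A ^ i * B ^ (k - i) * (k.choose i))) *
          ((i.factorial : ℝ) ^ s * ((k - i).factorial : ℝ) ^ s) := by ring
    _ ≤ (M * N * (A ^ i * B ^ (k - i) * (k.choose i))) * (k.factorial : ℝ) ^ s := by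
        gcongr
        exact factorial_rpow_mul_le hs hik
    _ = _ := by ring

theorem GevreyBounds.comp_clm {G : Type*} [NormedAddCommGroup G] [NormedSpace ℝ G] {s A M : ℝ}
    {f : E → F} (hf : ContDiff ℝ ∞ f) (Hf : GevreyBounds s A M f) (L : G →L[ℝ] E) :
    GevreyBounds s (A * ‖L‖) M (fun x => f (L x)) := by
  intro k x
  have h := L.iteratedFDeriv_comp_right hf x (natCast_le_infty k)
  change ‖iteratedFDeriv ℝ k (f ∘ L) x‖ ≤ _
  rw [h]
  refine (ContinuousMultilinearMap.norm_compContinuousLinearMap_le _ _).trans ?_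
  rw [Finset.prod_const, Finset.card_univ, Fintype.card_fin]
  calc _ ≤ M * (A ^ k * (k.factorial : ℝ) ^ s) * ‖L‖ ^ k := by gcongr; exact Hf k (L x)
    _ = _ := by rw [mul_pow]; ring

theorem GevreyBounds.sub {s A M N : ℝ} {f g : E → F} (hf : ContDiff ℝ ∞ f) (hg : ContDiff ℝ ∞ g)
    (Hf : GevreyBounds s A M f) (Hg : GevreyBounds s A N g) :
    GevreyBounds s A (M + N) (fun x => f x - g x) := by
  intro k x
  have h : iteratedFDeriv ℝ k (fun x => f x - g x) x =
      iteratedFDeriv ℝ k f x - iteratedFDeriv ℝ k g x :=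
    iteratedFDeriv_sub_apply (hf.of_le (natCast_le_infty k)).contDiffAt
      (hg.of_le (natCast_le_infty k)).contDiffAt
  rw [h, add_mul]
  exact (norm_sub_le _ _).trans (add_le_add (Hf k x) (Hg k x))

theorem GevreyBounds.mono {s A B M : ℝ} {f : E → F} (Hf : GevreyBounds s A M f) (hA : 0 ≤ A)
    (hAB : A ≤ B) : GevreyBounds s B M f := by
  intro k x
  have hM : 0 ≤ M := by have := (norm_nonneg _).trans (Hf 0 x); simpa using this
  refine (Hf k x).trans ?_
  gcongr

end

theorem gevreyBounds_real_iff {F : Type*} [NormedAddCommGroup F] [NormedSpace ℝ F]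
    {s A M : ℝ} {f : ℝ → F} : GevreyBounds s A M f ↔
      ∀ (k : ℕ) (x : ℝ), ‖iteratedDeriv k f x‖ ≤ M * (A ^ k * (k.factorial : ℝ) ^ s) := by
  simp only [GevreyBounds, norm_iteratedFDeriv_eq_norm_iteratedDeriv]

theorem GevreyBounds.comp_affine {s A M : ℝ} {f : ℝ → ℝ} (hf : ContDiff ℝ ∞ f)
    (Hf : GevreyBounds s A M f) (a b : ℝ) :
    GevreyBounds s (A * |a|) M (fun x => f (a * x + b)) := by
  rw [gevreyBounds_real_iff] at Hf ⊢
  intro k x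
  have hf' : ContDiff ℝ k (fun x => f (x + b)) :=
    (hf.comp (contDiff_id.add contDiff_const)).of_le (natCast_le_infty k)
  rw [congrFun (iteratedDeriv_comp_const_mul hf' a) x, iteratedDeriv_comp_add_const, norm_mul,
    norm_pow, Real.norm_eq_abs a]
  calc _ ≤ |a| ^ k * (M * (A ^ k * (k.factorial : ℝ) ^ s)) := by gcongr; exact Hf k _
    _ = _ := by rw [mul_pow]; ring

/-! ### The flat function `exp (-1 / t ^ N)` -/

/-- Passes from real to complex derivatives, so that Cauchy's estimates apply to the flat function.
-/
theorem ofReal_iteratedDeriv_eq_of_eqOn {g : ℝ → ℝ} {f : ℂ → ℂ} {U : Set ℝ} (hU : IsOpen U)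
    (hg : ContDiff ℝ ∞ g) (hf : ∀ t ∈ U, AnalyticAt ℂ f t) (hfg : ∀ t ∈ U, (g t : ℂ) = f t)
    (k : ℕ) : ∀ t ∈ U, ((iteratedDeriv k g t : ℝ) : ℂ) = iteratedDeriv k f t := by
  induction k with
  | zero => simpa using hfg
  | succ k ih =>
    intro t ht
    rw [iteratedDeriv_succ, iteratedDeriv_succ]
    have h1 : HasDerivAt (iteratedDeriv k g) (deriv (iteratedDeriv k g) t) t := by
      refine (ContDiff.differentiable_iteratedDeriv k hg ?_ t).hasDerivAt
      exact_mod_cast WithTop.coe_lt_top (k : ℕ)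
    have h2 : AnalyticAt ℂ (iteratedDeriv k f) t := by
      rw [iteratedDeriv_eq_iterate]; exact (hf t ht).iterated_deriv k
    have h3 := h2.differentiableAt.hasDerivAt.comp_ofReal
    have h4 : (fun y : ℝ => ((iteratedDeriv k g y : ℝ) : ℂ)) =ᶠ[𝓝 t]
        fun y : ℝ => iteratedDeriv k f y := by
      filter_upwards [hU.mem_nhds ht] with y hy using ih y hy
    exact h1.ofReal_comp.unique (h3.congr_of_eventuallyEq h4)

theorem iteratedDeriv_eq_zero_of_eqOn_Iio {F : Type*} [NormedAddCommGroup F] [NormedSpace ℝ F]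
    {g : ℝ → F} {a : ℝ} (hg : ContDiff ℝ ∞ g)
    (h0 : ∀ t < a, g t = 0) (k : ℕ) : ∀ t ≤ a, iteratedDeriv k g t = 0 := by
  have h1 : ∀ t < a, iteratedDeriv k g t = 0 := by
    intro t ht
    have : g =ᶠ[𝓝 t] fun _ => 0 := by
      filter_upwards [Iio_mem_nhds ht] with y hy using h0 y hy
    rw [this.iteratedDeriv_eq k]
    simp
  intro t ht
  have hc : Continuous (iteratedDeriv k g) := hg.continuous_iteratedDeriv k (natCast_le_infty k)
  have hcl : IsClosed {t | iteratedDeriv k g t = 0} := isClosed_eq hc continuous_const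
  have : closure (Iio a) ⊆ {t | iteratedDeriv k g t = 0} := hcl.closure_subset_iff.mpr h1
  rw [closure_Iio] at this
  exact this ht

theorem exists_half_le_re_inv_pow (N : ℕ) :
    ∃ r : ℝ, 0 < r ∧ r < 1 ∧ ∀ w : ℂ, ‖w - 1‖ ≤ r → 1 / 2 ≤ ((w ^ N)⁻¹).re := by
  have hc : ContinuousAt (fun w : ℂ => ((w ^ N)⁻¹).re) 1 := by
    refine Complex.continuous_re.continuousAt.comp ?_
    exact ContinuousAt.inv₀ (by fun_prop) (by simp)
  have h1 : (1 / 2 : ℝ) < ((((1 : ℂ) ^ N)⁻¹).re) := by norm_num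
  have h2 := hc.eventually (lt_mem_nhds h1)
  obtain ⟨ε, hε, h⟩ := Metric.eventually_nhds_iff.mp h2
  refine ⟨min (ε / 2) (1 / 2), by positivity, by
    exact (min_le_right _ _).trans_lt (by norm_num), fun w hw => (h ?_).le⟩
  rw [dist_eq_norm]
  exact (hw.trans (min_le_left _ _)).trans_lt (by linarith)

/-- The N-th power of the inequality follows from y^k/k! ≤ exp y with y = N X^N / 2. With X = 1/t
this is the source of the extra 1/N in the Gevrey order. -/
theorem pow_mul_exp_neg_le {N : ℕ} (hN : 1 ≤ N) (k : ℕ) {X : ℝ} (hX : 0 ≤ X) :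
    X ^ k * Real.exp (-(X ^ N / 2)) ≤ 2 ^ k * (k.factorial : ℝ) ^ (1 / (N : ℝ)) := by
  have hN0 : (N : ℝ) ≠ 0 := by positivity
  have hN1 : (1 : ℝ) ≤ N := by exact_mod_cast hN
  have hpow : (X ^ k * Real.exp (-(X ^ N / 2))) ^ N ≤
      (2 ^ k * (k.factorial : ℝ) ^ (1 / (N : ℝ))) ^ N := by
    have e1 : ((k.factorial : ℝ) ^ (1 / (N : ℝ))) ^ N = k.factorial := by
      rw [← Real.rpow_natCast, ← Real.rpow_mul (by positivity), one_div_mul_cancel hN0,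
        Real.rpow_one]
    rw [mul_pow, mul_pow, e1, ← Real.exp_nat_mul, ← pow_mul, mul_comm k N, pow_mul]
    set Y := X ^ N
    have hY : 0 ≤ Y := by positivity
    have h1 := Real.pow_div_factorial_le_exp (N * (Y / 2)) (by positivity) k
    rw [div_le_iff₀ (by positivity)] at h1
    have h2 : Y ^ k ≤ 2 ^ k * (N * (Y / 2)) ^ k := by
      rw [← mul_pow]
      refine pow_le_pow_left₀ hY ?_ k
      nlinarith
    have h3 : (2 : ℝ) ^ k ≤ (2 ^ k) ^ N := by
      exact le_self_pow₀ (one_le_pow₀ (by norm_num)) (by omega)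
    calc Y ^ k * Real.exp (N * -(Y / 2))
        ≤ 2 ^ k * (Real.exp (N * (Y / 2)) * k.factorial) * Real.exp (N * -(Y / 2)) := by
          gcongr
          exact h2.trans (by gcongr)
      _ = 2 ^ k * k.factorial * (Real.exp (N * (Y / 2)) * Real.exp (N * -(Y / 2))) := by ring
      _ = 2 ^ k * k.factorial := by rw [← Real.exp_add]; simp
      _ ≤ _ := by gcongr
  exact le_of_pow_le_pow_left₀ (by omega) (by positivity) hpow

/-- Cauchy's estimate on the disc of radius r t about t > 0. By homogeneity one r serves all t:
there Re z^(-N) ≥ t^(-N)/2, and the resulting decay pays for (r t)^(-k). Oddness of N makes the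
function vanish for t ≤ 0. -/
theorem exists_gevreyBounds_expNegInvGlue_pow {N : ℕ} (hN : Odd N) :
    ∃ A : ℝ, 0 < A ∧ GevreyBounds (1 + 1 / (N : ℝ)) A 1 (fun t : ℝ => expNegInvGlue (t ^ N)) := by
  have hN1 : 1 ≤ N := hN.pos
  obtain ⟨r, hr, hr1, hre⟩ := exists_half_le_re_inv_pow N
  refine ⟨2 / r, by positivity, ?_⟩
  rw [gevreyBounds_real_iff]
  have hsm : ContDiff ℝ ∞ (fun t : ℝ => expNegInvGlue (t ^ N)) :=
    expNegInvGlue.contDiff.comp (contDiff_id.pow N)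
  intro k t
  rcases le_or_gt t 0 with ht | ht
  · rw [iteratedDeriv_eq_zero_of_eqOn_Iio hsm (a := 0) ?_ k t ht]
    · rw [norm_zero]; positivity
    · intro t ht
      exact expNegInvGlue.zero_of_nonpos (hN.pow_nonpos ht.le)
  set f : ℂ → ℂ := fun z => Complex.exp (-(z ^ N)⁻¹)
  have hfan : ∀ z : ℂ, z ≠ 0 → AnalyticAt ℂ f z := by
    intro z hz
    exact (((analyticAt_id.pow N).inv (pow_ne_zero N hz)).neg).cexp
  have hk := ofReal_iteratedDeriv_eq_of_eqOn (f := f) isOpen_Ioi hsm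
    (fun t ht => hfan t (by exact_mod_cast (mem_Ioi.mp ht).ne')) (fun t ht => by
      have : ¬ t ^ N ≤ 0 := not_le.mpr (pow_pos (mem_Ioi.mp ht) N)
      simp only [expNegInvGlue, this, if_false, f]
      push_cast
      rfl) k t (mem_Ioi.mpr ht)
  have hball : ∀ z : ℂ, ‖z - t‖ ≤ r * t → z ≠ 0 ∧ (t⁻¹ ^ N) / 2 ≤ ((z ^ N)⁻¹).re := by
    intro z hz
    constructor
    · rintro rfl
      rw [zero_sub, norm_neg, Complex.norm_real, Real.norm_of_nonneg ht.le] at hz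
      nlinarith
    · have htc : (t : ℂ) ≠ 0 := by exact_mod_cast ht.ne'
      have hw : ‖z / t - 1‖ ≤ r := by
        have : z / t - 1 = (z - t) / t := by field_simp
        rw [this, norm_div, Complex.norm_real, Real.norm_of_nonneg ht.le, div_le_iff₀ ht]
        exact hz
      have h1 := hre _ hw
      have h2 : (z ^ N)⁻¹ = ((t⁻¹ ^ N : ℝ) : ℂ) * ((z / t) ^ N)⁻¹ := by
        push_cast
        rw [div_pow, inv_div, inv_pow]
        have : (t : ℂ) ^ N ≠ 0 := pow_ne_zero _ htc
        rw [div_eq_mul_inv, ← mul_assoc, inv_mul_cancel₀ this, one_mul]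
      rw [h2, Complex.re_ofReal_mul]
      have : 0 < t⁻¹ ^ N := by positivity
      nlinarith
  have hcauchy := Complex.norm_iteratedDeriv_le_of_forall_mem_sphere_norm_le (f := f) (c := t)
    (R := r * t) (C := Real.exp (-(t⁻¹ ^ N / 2))) k (by positivity) ?_ ?_
  · rw [← Complex.norm_real, hk]
    refine hcauchy.trans ?_
    have h1 := pow_mul_exp_neg_le hN1 k (inv_nonneg.mpr ht.le)
    have hfac : (k.factorial : ℝ) ^ (1 + 1 / (N : ℝ)) =
        k.factorial * (k.factorial : ℝ) ^ (1 / (N : ℝ)) := by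
      rw [Real.rpow_add (by positivity), Real.rpow_one]
    rw [hfac, one_mul]
    calc (k.factorial : ℝ) * Real.exp (-(t⁻¹ ^ N / 2)) / (r * t) ^ k
        = k.factorial / r ^ k * (t⁻¹ ^ k * Real.exp (-(t⁻¹ ^ N / 2))) := by
          rw [mul_pow, inv_pow t k]; field_simp
      _ ≤ k.factorial / r ^ k * (2 ^ k * (k.factorial : ℝ) ^ (1 / (N : ℝ))) := by gcongr
      _ = _ := by rw [div_pow]; ring
  · refine (DifferentiableOn.diffContOnCl ?_)
    intro z hz
    refine (hfan z (hball z ?_).1).differentiableAt.differentiableWithinAt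
    have := Metric.closure_ball_subset_closedBall hz
    rwa [Metric.mem_closedBall, dist_eq_norm] at this
  · intro z hz
    rw [mem_sphere_iff_norm] at hz
    have := (hball z hz.le).2
    simp only [f, Complex.norm_exp, Complex.neg_re]
    exact Real.exp_le_exp.mpr (by linarith)

/-! ### Cutoff functions of Gevrey order close to 1 -/

/-- For every odd `N` there are a bump function `b` and a step function `H` of Gevrey order
`1 + 1 / N`. -/
theorem exists_gevrey_bump_and_step {N : ℕ} (hN : Odd N) :
    ∃ (A M : ℝ) (b H : ℝ → ℝ), 0 < A ∧ 0 < M ∧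
      ContDiff ℝ ∞ b ∧ GevreyBounds (1 + 1 / (N : ℝ)) A M b ∧
      (∀ t, 0 ≤ b t) ∧ (∀ t ∈ Ioo (0 : ℝ) 1, 0 < b t) ∧ (∀ t ∉ Ioo (0 : ℝ) 1, b t = 0) ∧
      ContDiff ℝ ∞ H ∧ GevreyBounds (1 + 1 / (N : ℝ)) A M H ∧
      (∀ t, 0 ≤ H t) ∧ (∀ t, H t ≤ 1) ∧ (∀ t ≤ 0, H t = 0) ∧ (∀ t, 1 ≤ t → H t = 1) := by
  obtain ⟨A₀, hA₀, hg⟩ := exists_gevreyBounds_expNegInvGlue_pow hN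
  set g : ℝ → ℝ := fun t => expNegInvGlue (t ^ N)
  have hgs : ContDiff ℝ ∞ g := expNegInvGlue.contDiff.comp (contDiff_id.pow N)
  have hg' := hg.comp_affine hgs (-1) 1
  have hgs' : ContDiff ℝ ∞ (fun t : ℝ => g (-1 * t + 1)) := by fun_prop
  have hs : (0 : ℝ) ≤ 1 + 1 / (N : ℝ) := by positivity
  have hb := hg.mul hs hA₀.le (by positivity) hgs hgs' hg'
  set b : ℝ → ℝ := fun t => g t * g (-1 * t + 1)
  have hbs : ContDiff ℝ ∞ b := hgs.mul hgs'
  have hg0 : ∀ t ≤ 0, g t = 0 := fun t ht => expNegInvGlue.zero_of_nonpos (hN.pow_nonpos ht)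
  have hgp : ∀ t > 0, 0 < g t := fun t ht => expNegInvGlue.pos_of_pos (pow_pos ht N)
  have hgnn : ∀ t, 0 ≤ g t := fun t => expNegInvGlue.nonneg _
  have hbnn : ∀ t, 0 ≤ b t := fun t => mul_nonneg (hgnn _) (hgnn _)
  have hbpos : ∀ t ∈ Ioo (0 : ℝ) 1, 0 < b t := fun t ht =>
    mul_pos (hgp _ ht.1) (hgp _ (by linarith [ht.2]))
  have hb0 : ∀ t ∉ Ioo (0 : ℝ) 1, b t = 0 := by
    intro t ht
    rw [mem_Ioo, not_and_or, not_lt, not_lt] at ht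
    rcases ht with ht | ht
    · simp [b, hg0 t ht]
    · change g t * g (-1 * t + 1) = 0
      rw [hg0 (-1 * t + 1) (by linarith), mul_zero]
  set A : ℝ := A₀ + A₀ * |(-1 : ℝ)|
  have hA : 0 < A := by positivity
  rw [one_mul] at hb
  have hbc : Continuous b := hbs.continuous
  have hii : ∀ u v : ℝ, IntervalIntegrable b volume u v := fun u v => hbc.intervalIntegrable u v
  set I : ℝ := ∫ t in (0 : ℝ)..1, b t
  have hI : 0 < I :=
    intervalIntegral.intervalIntegral_pos_of_pos_on (hii 0 1) hbpos zero_lt_one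
  -- The normalised primitive of b: its derivatives of positive order are those of b shifted by one.
  set H : ℝ → ℝ := fun t => I⁻¹ * ∫ u in (0 : ℝ)..t, b u
  have hHd : ∀ t, HasDerivAt H (I⁻¹ * b t) t := fun t =>
    (intervalIntegral.integral_hasDerivAt_right (hii 0 t)
      (hbc.stronglyMeasurableAtFilter _ _) hbc.continuousAt).const_mul _
  have hHderiv : deriv H = fun t => I⁻¹ * b t := funext fun t => (hHd t).deriv
  have hHs : ContDiff ℝ ∞ H := by
    refine contDiff_infty_iff_deriv.mpr ⟨fun t => (hHd t).differentiableAt, ?_⟩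
    rw [hHderiv]
    exact contDiff_const.mul hbs
  have hH0 : ∀ t ≤ 0, H t = 0 := by
    intro t ht
    have : ∫ u in (0 : ℝ)..t, b u = 0 := by
      rw [intervalIntegral.integral_congr (g := fun _ => (0 : ℝ))]
      · simp
      · intro u hu
        rw [uIcc_of_ge ht] at hu
        exact hb0 u fun h => absurd h.1 (not_lt.mpr hu.2)
    simp [H, this]
  have hH1 : ∀ t, 1 ≤ t → H t = 1 := by
    intro t ht
    have h1 : ∫ u in (1 : ℝ)..t, b u = 0 := by
      rw [intervalIntegral.integral_congr (g := fun _ => (0 : ℝ))]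
      · simp
      · intro u hu
        rw [uIcc_of_le ht] at hu
        exact hb0 u fun h => absurd h.2 (not_lt.mpr hu.1)
    have h2 := intervalIntegral.integral_add_adjacent_intervals (hii 0 1) (hii 1 t)
    simp only [H, ← h2, h1, add_zero]
    exact inv_mul_cancel₀ hI.ne'
  have hHmono : Monotone H := monotone_of_deriv_nonneg (hHs.differentiable (by simp)) fun t => by
    rw [hHderiv]; exact mul_nonneg (inv_nonneg.mpr hI.le) (hbnn t)
  have hHnn : ∀ t, 0 ≤ H t := fun t => by
    rw [← hH0 (min t 0) (min_le_right _ _)]; exact hHmono (min_le_left _ _)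
  have hHle : ∀ t, H t ≤ 1 := fun t => by
    rw [← hH1 (max t 1) (le_max_right _ _)]; exact hHmono (le_max_left _ _)
  -- Radius at least 1 absorbs the index shift k to k+1; the constant must dominate both H ≤ 1 and
  -- the factor I⁻¹.
  refine ⟨max A 1, max 1 I⁻¹, b, H, by positivity, by positivity, hbs, ?_, hbnn, hbpos, hb0, hHs,
    ?_, hHnn, hHle, hH0, hH1⟩
  · intro k x
    refine ((hb.mono hA.le (le_max_left A 1)) k x).trans ?_
    gcongr
    exact le_max_left _ _
  · rw [gevreyBounds_real_iff]
    intro k x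
    cases k with
    | zero =>
      rw [iteratedDeriv_zero, Real.norm_of_nonneg (hHnn x)]
      simp only [pow_zero, Nat.factorial_zero, Nat.cast_one, Real.one_rpow, mul_one]
      exact (hHle x).trans (le_max_left _ _)
    | succ k =>
      rw [iteratedDeriv_succ', hHderiv, iteratedDeriv_const_mul_field, norm_mul,
        Real.norm_of_nonneg (inv_nonneg.mpr hI.le)]
      have h1 := gevreyBounds_real_iff.mp (hb.mono hA.le (le_max_left A 1)) k x
      rw [one_mul] at h1
      refine (mul_le_mul_of_nonneg_left h1 (inv_nonneg.mpr hI.le)).trans ?_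
      gcongr
      · exact le_max_right _ _
      · exact le_max_right _ _
      · exact Nat.le_succ k
      · exact Nat.le_succ k

/-! ### Decay of test functions at the boundary of `U₁` -/

/-- Taylor's estimate with vanishing data at a, by integrating the bound k times. -/
theorem norm_le_of_norm_iteratedDeriv_le {F : Type*} [NormedAddCommGroup F] [NormedSpace ℝ F]
    {a b C : ℝ} (k : ℕ) : ∀ {ψ : ℝ → F}, ContDiff ℝ ∞ ψ → (∀ t < a, ψ t = 0) →
      (∀ t ∈ Icc a b, ‖iteratedDeriv k ψ t‖ ≤ C) →
      ∀ t ∈ Icc a b, ‖ψ t‖ ≤ C * (t - a) ^ k / k.factorial := by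
  induction k with
  | zero => intro ψ _ _ h t ht; simpa using h t ht
  | succ k ih =>
    intro ψ hψ h0 h
    have hψ' := contDiff_infty_iff_deriv.mp hψ
    have hd0 : ∀ t < a, deriv ψ t = 0 := fun t ht => by
      simpa using iteratedDeriv_eq_zero_of_eqOn_Iio hψ h0 1 t ht.le
    have hd := ih hψ'.2 hd0 (by simpa only [← iteratedDeriv_succ'] using h)
    have ha : ψ a = 0 := by
      simpa using iteratedDeriv_eq_zero_of_eqOn_Iio hψ h0 0 a le_rfl
    intro t ht
    refine image_norm_le_of_norm_deriv_right_le_deriv_boundary (f' := deriv ψ)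
      (B := fun t => C * (t - a) ^ (k + 1) / (k + 1).factorial)
      (B' := fun t => C * (t - a) ^ k / k.factorial)
      hψ.continuous.continuousOn (fun x _ => (hψ'.1 x).hasDerivAt.hasDerivWithinAt) ?_ ?_
      (fun x hx => hd x (Ico_subset_Icc_self hx)) ht
    · simp [ha]
    · intro x
      have h1 := ((((hasDerivAt_id x).sub_const a).pow (k + 1)).const_mul C).div_const
        ((k + 1).factorial : ℝ)
      refine h1.congr_deriv ?_
      rw [Nat.factorial_succ]
      push_cast
      have : (k.factorial : ℝ) ≠ 0 := by positivity
      have : (k : ℝ) + 1 ≠ 0 := by positivity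
      simp only [id]
      field_simp

/-- The vertical unit vector. -/
noncomputable def vert : Rn 2 := EuclideanSpace.single 1 1

/-- The `k`-th vertical derivative. -/
noncomputable def vertDeriv (k : ℕ) (φ : Rn 2 → ℂ) (z : Rn 2) : ℂ := iteratedFDeriv ℝ k φ z (fun _ => vert)

theorem norm_vert : ‖vert‖ = 1 := by simp [vert]

theorem iteratedDeriv_vertical {φ : Rn 2 → ℂ} (hφ : ContDiff ℝ ∞ φ) (z : Rn 2) (k : ℕ) (t : ℝ) :
    iteratedDeriv k (fun t : ℝ => φ (z + t • vert)) t = vertDeriv k φ (z + t • vert) := by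
  have h1 : ContDiff ℝ ∞ (fun w => φ (z + w)) := hφ.comp (contDiff_const.add contDiff_id)
  have h2 := (ContinuousLinearMap.toSpanSingleton ℝ vert).iteratedFDeriv_comp_right h1 t
    (natCast_le_infty k)
  have h3 : (fun t : ℝ => φ (z + t • vert)) =
      (fun w => φ (z + w)) ∘ (ContinuousLinearMap.toSpanSingleton ℝ vert) := by
    ext t; simp
  rw [iteratedDeriv_eq_iteratedFDeriv, h3, h2, iteratedFDeriv_comp_add_left]
  simp [vertDeriv]

/-- Otherwise x^k/k! < (exp x / 2) 2^(-k) for every k, and summing gives exp x < exp x. -/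
theorem exists_exp_le_two_mul_pow_div_factorial (x : ℝ) :
    ∃ k : ℕ, Real.exp x ≤ 2 * ((2 * x) ^ k / k.factorial) := by
  by_contra! H
  have hs1 : HasSum (fun k : ℕ => x ^ k / k.factorial) (Real.exp x) := by
    rw [Real.exp_eq_exp_ℝ]
    exact NormedSpace.expSeries_div_hasSum_exp x
  have hs2 : HasSum (fun k : ℕ => Real.exp x / 2 * (1 / 2 : ℝ) ^ k) (Real.exp x / 2 * 2) :=
    hasSum_geometric_two.mul_left _
  have hlt : ∀ k : ℕ, x ^ k / k.factorial < Real.exp x / 2 * (1 / 2 : ℝ) ^ k := by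
    intro k
    have h := H k
    rw [mul_pow] at h
    have h2 : (0 : ℝ) < 2 ^ k := by positivity
    rw [one_div, inv_pow, ← div_eq_mul_inv, lt_div_iff₀ h2]
    have : 2 * (2 ^ k * x ^ k / (k.factorial : ℝ)) = 2 * (x ^ k / k.factorial * 2 ^ k) := by ring
    linarith
  have := hasSum_strict_mono hs1 hs2 (Pi.lt_def.mpr ⟨fun k => (hlt k).le, 0, hlt 0⟩)
  linarith

/-- The radius for which the Gevrey bounds of order `τ + 1` compensate `exp (t ^ (-1 / τ))`. -/
noncomputable def critRadius (τ : ℝ) : ℝ := (τ / 2) ^ τ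

theorem critRadius_pos {τ : ℝ} (hτ : 0 < τ) : 0 < critRadius τ :=
  Real.rpow_pos_of_pos (by positivity) _

/-- Take a dominant term of the series of exp(X/τ), X = t^(-1/τ), and raise to the power τ: since
X^τ = 1/t, the base 2X/τ becomes 1/(t · `critRadius τ`). This dictates the value of the radius. -/
theorem exists_exp_mul_le {τ t : ℝ} (hτ : 0 < τ) (ht : 0 < t) :
    ∃ k : ℕ, Real.exp (t ^ (-(1 / τ))) * (t ^ k * (critRadius τ ^ k * (k.factorial : ℝ) ^ τ))
      ≤ 2 ^ τ := by
  set X := t ^ (-(1 / τ)) with hX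
  have hXpos : 0 < X := Real.rpow_pos_of_pos ht _
  obtain ⟨k, hk⟩ := exists_exp_le_two_mul_pow_div_factorial (X / τ)
  refine ⟨k, ?_⟩
  have hXt : X ^ τ = t⁻¹ := by
    rw [hX, ← Real.rpow_mul ht.le, neg_mul, one_div_mul_cancel hτ.ne', Real.rpow_neg_one]
  have h1 := Real.rpow_le_rpow (Real.exp_pos _).le hk hτ.le
  rw [← Real.exp_mul, div_mul_cancel₀ X hτ.ne', Real.mul_rpow (by norm_num) (by positivity),
    Real.div_rpow (by positivity) (by positivity), ← Real.rpow_natCast, ← Real.rpow_mul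
    (by positivity), mul_comm (k : ℝ) τ, Real.rpow_mul (by positivity),
    Real.rpow_natCast] at h1
  have h2 : (2 * (X / τ)) ^ τ = (t * critRadius τ)⁻¹ := by
    have : 2 * (X / τ) = X * (τ / 2)⁻¹ := by field_simp
    rw [this, Real.mul_rpow hXpos.le (by positivity), hXt, Real.inv_rpow (by positivity),
      critRadius, mul_inv]
  rw [h2] at h1
  have hr := critRadius_pos hτ
  have hf : (0 : ℝ) < (k.factorial : ℝ) ^ τ := by positivity
  calc _ ≤ 2 ^ τ * ((t * critRadius τ)⁻¹ ^ k / (k.factorial : ℝ) ^ τ) *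
        (t ^ k * (critRadius τ ^ k * (k.factorial : ℝ) ^ τ)) := by gcongr
    _ = 2 ^ τ := by
        rw [← mul_assoc (t ^ k), ← mul_pow, inv_pow]
        have : (t * critRadius τ) ^ k ≠ 0 := by positivity
        field_simp

/-- The function `exp ((y - x ^ (2 l + 1)) ^ (-1 / τ))`, cut off to `y > 0`. -/
noncomputable def expFun (τ : ℝ) (l : ℕ) (p : Rn 2) : ℂ :=
  if 0 < p 1 then (Real.exp ((p 1 - p 0 ^ (2 * l + 1)) ^ (-(1 / τ))) : ℂ) else 0

theorem norm_expFun_le (τ : ℝ) (l : ℕ) (p : Rn 2) :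
    ‖expFun τ l p‖ ≤ Real.exp ((p 1 - p 0 ^ (2 * l + 1)) ^ (-(1 / τ))) := by
  unfold expFun
  split_ifs
  · rw [Complex.norm_real, Real.norm_of_nonneg (Real.exp_pos _).le]
  · simpa using (Real.exp_pos _).le

theorem measurable_expFun (τ : ℝ) (l : ℕ) : Measurable (expFun τ l) := by
  have h0 : Measurable fun p : Rn 2 => p 0 := by fun_prop
  have h1 : Measurable fun p : Rn 2 => p 1 := by fun_prop
  refine Measurable.ite (measurableSet_lt measurable_const h1) ?_ measurable_const
  exact Complex.measurable_ofReal.comp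
    (Real.measurable_exp.comp ((h1.sub (h0.pow_const _)).pow_const _))

/-- A smooth function supported in `U₁` with weighted Gevrey bounds on its vertical derivatives
absorbs the growth of `expFun`. -/
theorem norm_expFun_mul_le {τ P : ℝ} (hτ : 0 < τ) {l : ℕ} {φ : Rn 2 → ℂ} (hφ : ContDiff ℝ ∞ φ)
    (hsupp : tsupport φ ⊆ U₁ l)
    (hP : ∀ (k : ℕ) (z : Rn 2), (1 + ‖z‖) ^ 3 * ‖vertDeriv k φ z‖ ≤
      P * (critRadius τ ^ k * (k.factorial : ℝ) ^ (τ + 1))) (z : Rn 2) (hz : z ∈ U₁ l) :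
    ‖expFun τ l z * φ z‖ ≤ (8 * 2 ^ τ + Real.exp 1) * P * (1 + ‖z‖) ^ (-3 : ℝ) := by
  have hP0 : 0 ≤ P := by
    have := (by positivity : 0 ≤ (1 + ‖z‖) ^ 3 * ‖vertDeriv 0 φ z‖).trans (hP 0 z)
    simpa using this
  have hw : 0 < 1 + ‖z‖ := by positivity
  rw [show (-3 : ℝ) = -((3 : ℕ) : ℝ) by norm_num, Real.rpow_neg hw.le, Real.rpow_natCast, norm_mul,
    ← div_eq_mul_inv, le_div_iff₀ (by positivity)]
  have hr := critRadius_pos hτ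
  have h2τ : (0 : ℝ) < 2 ^ τ := by positivity
  set t : ℝ := z 1 - z 0 ^ (2 * l + 1) with ht
  have ht0 : 0 < t := sub_pos.mpr hz
  have hu : ‖expFun τ l z‖ ≤ Real.exp (t ^ (-(1 / τ))) := norm_expFun_le τ l z
  -- For t ≤ 1, Taylor along the vertical segment down to the boundary; for t > 1, `expFun` is at
  -- most e and only the bound of order 0 is needed.
  rcases le_or_gt t 1 with ht1 | ht1
  · obtain ⟨k, hk⟩ := exists_exp_mul_le hτ ht0
    set ψ : ℝ → ℂ := fun s => φ (z + s • vert) with hψ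
    have hψs : ContDiff ℝ ∞ ψ := hφ.comp (contDiff_const.add (contDiff_id.smul contDiff_const))
    have hψ0 : ∀ s < -t, ψ s = 0 := by
      intro s hs
      by_contra hne
      have hmem : z + s • vert ∈ U₁ l := hsupp (subset_tsupport _ hne)
      have h3 : (z + s • vert) 0 ^ (2 * l + 1) < (z + s • vert) 1 := hmem
      simp [vert] at h3
      linarith
    have hbd : ∀ s ∈ Icc (-t) 0, ‖iteratedDeriv k ψ s‖ ≤
        8 * P * (critRadius τ ^ k * (k.factorial : ℝ) ^ (τ + 1)) / (1 + ‖z‖) ^ 3 := by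
      intro s hs
      rw [iteratedDeriv_vertical hφ, le_div_iff₀ (by positivity)]
      set z' := z + s • vert with hz'
      have hzz : ‖z‖ ≤ ‖z'‖ + 1 := by
        have h4 : z = z' - s • vert := by rw [hz']; abel
        calc ‖z‖ = ‖z' - s • vert‖ := by rw [← h4]
          _ ≤ ‖z'‖ + ‖s • vert‖ := norm_sub_le _ _
          _ ≤ ‖z'‖ + 1 := by
            rw [norm_smul, norm_vert, mul_one, Real.norm_eq_abs]
            have : |s| ≤ 1 := abs_le.mpr ⟨by linarith [hs.1], by linarith [hs.2]⟩
            linarith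
      -- The weight varies by at most 2^3 along a segment of length at most 1.
      have h5 : (1 + ‖z‖) ^ 3 ≤ 8 * (1 + ‖z'‖) ^ 3 := by
        have : 1 + ‖z‖ ≤ 2 * (1 + ‖z'‖) := by linarith [norm_nonneg z']
        calc (1 + ‖z‖) ^ 3 ≤ (2 * (1 + ‖z'‖)) ^ 3 := pow_le_pow_left₀ hw.le this 3
          _ = _ := by ring
      calc _ ≤ ‖vertDeriv k φ z'‖ * (8 * (1 + ‖z'‖) ^ 3) := by gcongr
        _ = 8 * ((1 + ‖z'‖) ^ 3 * ‖vertDeriv k φ z'‖) := by ring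
        _ ≤ 8 * (P * (critRadius τ ^ k * (k.factorial : ℝ) ^ (τ + 1))) := by
          exact mul_le_mul_of_nonneg_left (hP k z') (by norm_num)
        _ = _ := by ring
    have hT := norm_le_of_norm_iteratedDeriv_le k hψs hψ0 hbd 0 ⟨by linarith, le_rfl⟩
    simp only [hψ, zero_smul, add_zero, sub_neg_eq_add, zero_add] at hT
    rw [div_mul_eq_mul_div, div_div, le_div_iff₀ (by positivity)] at hT
    -- Taylor's 1/k! lowers the Gevrey order from τ + 1 to τ, the order matched by
    -- `exists_exp_mul_le`.
    have hfac : (k.factorial : ℝ) ^ (τ + 1) = (k.factorial : ℝ) ^ τ * k.factorial := by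
      rw [Real.rpow_add (by positivity), Real.rpow_one]
    rw [hfac] at hT
    have hkf : (0 : ℝ) < k.factorial := by positivity
    have hT' : ‖φ z‖ * (1 + ‖z‖) ^ 3 ≤
        8 * P * (t ^ k * (critRadius τ ^ k * (k.factorial : ℝ) ^ τ)) := by
      refine le_of_mul_le_mul_right ?_ hkf
      calc _ = ‖φ z‖ * ((1 + ‖z‖) ^ 3 * k.factorial) := by ring
        _ ≤ _ := hT
        _ = _ := by ring
    calc ‖expFun τ l z‖ * ‖φ z‖ * (1 + ‖z‖) ^ 3
        = ‖expFun τ l z‖ * (‖φ z‖ * (1 + ‖z‖) ^ 3) := by ring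
      _ ≤ Real.exp (t ^ (-(1 / τ))) *
          (8 * P * (t ^ k * (critRadius τ ^ k * (k.factorial : ℝ) ^ τ))) := by gcongr
      _ = 8 * P * (Real.exp (t ^ (-(1 / τ))) *
          (t ^ k * (critRadius τ ^ k * (k.factorial : ℝ) ^ τ))) := by ring
      _ ≤ 8 * P * 2 ^ τ := by gcongr
      _ ≤ _ := by nlinarith [mul_nonneg hP0 (Real.exp_pos 1).le]
  · have h6 : t ^ (-(1 / τ)) ≤ 1 :=
      Real.rpow_le_one_of_one_le_of_nonpos ht1.le (by
        rw [neg_nonpos]; positivity)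
    have h7 : ‖φ z‖ * (1 + ‖z‖) ^ 3 ≤ P := by
      have := hP 0 z
      simp only [vertDeriv, iteratedFDeriv_zero_apply, pow_zero, Nat.factorial_zero, Nat.cast_one,
        Real.one_rpow, mul_one] at this
      linarith
    calc ‖expFun τ l z‖ * ‖φ z‖ * (1 + ‖z‖) ^ 3
        = ‖expFun τ l z‖ * (‖φ z‖ * (1 + ‖z‖) ^ 3) := by ring
      _ ≤ Real.exp 1 * P := by
          gcongr
          exact hu.trans (Real.exp_le_exp.mpr h6)
      _ ≤ _ := by nlinarith [mul_nonneg hP0 h2τ.le]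

/-! ### Comparison of Gevrey classes -/

theorem pow_le_exp_mul_factorial_rpow {ρ x : ℝ} (hρ : 0 < ρ) (hx : 0 ≤ x) (k : ℕ) :
    x ^ k ≤ Real.exp (ρ * x ^ (1 / ρ)) * (k.factorial : ℝ) ^ ρ := by
  have h1 := Real.pow_div_factorial_le_exp (x ^ (1 / ρ)) (by positivity) k
  rw [div_le_iff₀ (by positivity)] at h1
  have h2 := Real.rpow_le_rpow (by positivity) h1 hρ.le
  rw [Real.mul_rpow (by positivity) (by positivity), ← Real.exp_mul, ← Real.rpow_natCast,
    ← Real.rpow_mul (by positivity), ← Real.rpow_mul hx,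
    show 1 / ρ * (k * ρ) = (k : ℝ) by field_simp, Real.rpow_natCast] at h2
  rwa [mul_comm ρ]

/-- A gap in the order allows any radius h to be traded for any r. The explicit constant matters: it
measures how the norm of a bump grows as the bump is rescaled. -/
theorem HasGevreyBound.of_order_lt {n : ℕ} {s σ h r M : ℝ} {φ : Rn n → ℂ}
    (H : HasGevreyBound s h M φ) (hsσ : s < σ) (hh : 0 < h) (hr : 0 < r) :
    HasGevreyBound σ r (Real.exp ((σ - s) * (h / r) ^ (1 / (σ - s))) * M) φ := by
  intro k j x
  have hM := H.nonneg
  refine (H k j x).trans ?_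
  have h1 := pow_le_exp_mul_factorial_rpow (sub_pos.mpr hsσ) (div_pos hh hr).le k
  have h2 : (k.factorial : ℝ) ^ σ = (k.factorial : ℝ) ^ (σ - s) * (k.factorial : ℝ) ^ s := by
    rw [← Real.rpow_add (by positivity), sub_add_cancel]
  have h3 : h ^ k = (h / r) ^ k * r ^ k := by rw [← mul_pow, div_mul_cancel₀ h hr.ne']
  rw [h2, h3]
  calc M * ((h / r) ^ k * r ^ k * (k.factorial : ℝ) ^ s)
      ≤ M * (Real.exp ((σ - s) * (h / r) ^ (1 / (σ - s))) * (k.factorial : ℝ) ^ (σ - s) *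
          r ^ k * (k.factorial : ℝ) ^ s) := by gcongr
    _ = _ := by ring

/-- The class `c` is contained in the Beurling class `(σ)`. -/
def ContainedIn (c : GevreyClass) (σ : ℝ) : Prop := c = .beurling σ ∨ c.order < σ

theorem IsGevrey.exists_bound {n : ℕ} {c : GevreyClass} {σ r : ℝ} (hc : ContainedIn c σ)
    (hr : 0 < r) {φ : Rn n → ℂ} (hφ : IsGevrey c φ) : ∃ M, HasGevreyBound σ r M φ := by
  rcases hc with rfl | hc
  · exact hφ r hr
  · cases c with
    | beurling s =>
      obtain ⟨M, hM⟩ := hφ 1 one_pos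
      exact ⟨_, hM.of_order_lt hc one_pos hr⟩
    | roumieu s =>
      obtain ⟨h, hh, M, hM⟩ := hφ
      exact ⟨_, hM.of_order_lt hc hh hr⟩

/-- If the order is below σ, every norm of that order dominates the norm of order σ and radius r,
which serves Beurling and Roumieu classes alike. -/
theorem isContinuousForm_of_containedIn {n : ℕ} {c : GevreyClass} {σ r : ℝ}
    (hc : ContainedIn c σ) (hr : 0 < r) {U : Opens (Rn n)} {T : testSpace c U →ₗ[ℂ] ℂ}
    (hT : ∀ K : Set (Rn n), IsCompact K → ∃ C, BoundedOn T K σ r C) : IsContinuousForm T := by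
  intro K hK _
  obtain ⟨C, hC⟩ := hT K hK
  rcases hc with rfl | hc
  · exact ⟨r, hr, C, hC⟩
  · cases c with
    | beurling s =>
      exact ⟨1, one_pos, _, fun φ hφ M hM =>
        (hC φ hφ _ (hM.of_order_lt hc one_pos hr)).trans_eq (mul_assoc _ _ _).symm⟩
    | roumieu s =>
      exact fun h hh => ⟨_, fun φ hφ M hM =>
        (hC φ hφ _ (hM.of_order_lt hc hh hr)).trans_eq (mul_assoc _ _ _).symm⟩

/-! ### Extension of `expFun` to an ultradistribution on the plane -/

theorem vertDeriv_add {φ ψ : Rn 2 → ℂ} (hφ : ContDiff ℝ ∞ φ) (hψ : ContDiff ℝ ∞ ψ) (k : ℕ)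
    (z : Rn 2) : vertDeriv k (φ + ψ) z = vertDeriv k φ z + vertDeriv k ψ z := by
  unfold vertDeriv
  rw [iteratedFDeriv_add_apply (hφ.of_le (natCast_le_infty k)).contDiffAt
    (hψ.of_le (natCast_le_infty k)).contDiffAt, add_apply]

theorem vertDeriv_smul (a : ℂ) {φ : Rn 2 → ℂ} (hφ : ContDiff ℝ ∞ φ) (k : ℕ)
    (z : Rn 2) : vertDeriv k (a • φ) z = a * vertDeriv k φ z := by
  unfold vertDeriv
  rw [iteratedFDeriv_const_smul_apply (hφ.of_le (natCast_le_infty k)).contDiffAt, smul_apply,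
    smul_eq_mul]

/-- The weighted vertical Gevrey ratios of order `τ + 1` with radius `critRadius τ`. -/
noncomputable def vertRatio (τ : ℝ) (φ : Rn 2 → ℂ) (q : ℕ × Rn 2) : ℝ :=
  (1 + ‖q.2‖) ^ 3 * ‖vertDeriv q.1 φ q.2‖ /
    (critRadius τ ^ q.1 * (q.1.factorial : ℝ) ^ (τ + 1))

theorem vertRatio_le {τ M R : ℝ} (hτ : 0 < τ) {φ : Rn 2 → ℂ}
    (hφ : tsupport φ ⊆ Metric.closedBall 0 R) (hM : HasGevreyBound (τ + 1) (critRadius τ) M φ)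
    (q : ℕ × Rn 2) : vertRatio τ φ q ≤ (1 + |R|) ^ 3 * M := by
  obtain ⟨k, z⟩ := q
  have hM0 := hM.nonneg
  have hr := critRadius_pos hτ
  unfold vertRatio
  rw [div_le_iff₀ (by positivity)]
  by_cases hz : z ∈ tsupport φ
  · have h1 : ‖z‖ ≤ |R| := (mem_closedBall_zero_iff.mp (hφ hz)).trans (le_abs_self R)
    calc _ ≤ (1 + |R|) ^ 3 * (M * (critRadius τ ^ k * (k.factorial : ℝ) ^ (τ + 1))) := by
          gcongr
          exact hM k (fun _ => 1) z
      _ = _ := by ring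
  · have h0 : vertDeriv k φ z = 0 := by
      have h2 : z ∉ Function.support (iteratedFDeriv ℝ k φ) :=
        fun h => hz (support_iteratedFDeriv_subset k h)
      rw [vertDeriv, Function.notMem_support.mp h2]
      rfl
    simp only [h0, norm_zero, mul_zero]
    positivity

theorem bddAbove_vertRatio {τ : ℝ} (hτ : 0 < τ) {c : GevreyClass} (hc : ContainedIn c (τ + 1))
    {U : Opens (Rn 2)} (φ : testSpace c U) :
    BddAbove (range (vertRatio τ (φ : Rn 2 → ℂ))) := by
  obtain ⟨R, hR⟩ := φ.2.2.1.isCompact.isBounded.subset_closedBall 0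
  obtain ⟨M, hM⟩ := φ.2.2.2.2.exists_bound hc (critRadius_pos hτ)
  exact ⟨_, forall_mem_range.mpr fun q => vertRatio_le hτ hR hM q⟩

/-- The supremum of the weighted vertical Gevrey ratios, a seminorm. -/
noncomputable def vertSeminorm {τ : ℝ} (hτ : 0 < τ) {c : GevreyClass}
    (hc : ContainedIn c (τ + 1)) (U : Opens (Rn 2)) : Seminorm ℂ (testSpace c U) :=
  Seminorm.of (fun φ => ⨆ q, vertRatio τ (φ : Rn 2 → ℂ) q)
    (by
      intro φ ψ
      refine ciSup_le fun q => ?_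
      refine le_trans ?_ (add_le_add (le_ciSup (bddAbove_vertRatio hτ hc φ) q)
        (le_ciSup (bddAbove_vertRatio hτ hc ψ) q))
      have hr := critRadius_pos hτ
      unfold vertRatio
      rw [Submodule.coe_add, vertDeriv_add φ.2.1 ψ.2.1, ← add_div, ← mul_add]
      gcongr
      exact norm_add_le _ _)
    (by
      intro a φ
      rw [Real.mul_iSup_of_nonneg (norm_nonneg a)]
      congr 1
      ext q
      unfold vertRatio
      rw [Submodule.coe_smul, vertDeriv_smul a φ.2.1, norm_mul]
      ring)

theorem vertRatio_le_vertSeminorm {τ : ℝ} (hτ : 0 < τ) {c : GevreyClass}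
    (hc : ContainedIn c (τ + 1)) {U : Opens (Rn 2)} (φ : testSpace c U) (q : ℕ × Rn 2) :
    vertRatio τ (φ : Rn 2 → ℂ) q ≤ vertSeminorm hτ hc U φ :=
  le_ciSup (bddAbove_vertRatio hτ hc φ) q

theorem vertSeminorm_le {τ : ℝ} (hτ : 0 < τ) {c : GevreyClass}
    (hc : ContainedIn c (τ + 1)) {U : Opens (Rn 2)} (φ : testSpace c U) {B : ℝ}
    (hB : ∀ q, vertRatio τ (φ : Rn 2 → ℂ) q ≤ B) : vertSeminorm hτ hc U φ ≤ B :=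
  ciSup_le hB

theorem norm_expFun_mul_le_vertSeminorm {τ : ℝ} (hτ : 0 < τ) {c : GevreyClass}
    (hc : ContainedIn c (τ + 1)) {l : ℕ} {U : Opens (Rn 2)} (φ : testSpace c U)
    (hφ : tsupport (φ : Rn 2 → ℂ) ⊆ U₁ l) (z : Rn 2) (hz : z ∈ U₁ l) :
    ‖expFun τ l z * (φ : Rn 2 → ℂ) z‖ ≤
      (8 * 2 ^ τ + Real.exp 1) * vertSeminorm hτ hc U φ * (1 + ‖z‖) ^ (-3 : ℝ) := by
  refine norm_expFun_mul_le hτ φ.2.1 hφ (fun k z => ?_) z hz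
  have hr := critRadius_pos hτ
  have h := vertRatio_le_vertSeminorm hτ hc φ (k, z)
  rwa [vertRatio, div_le_iff₀ (by positivity)] at h

/-- The exponent 3 exceeds the dimension 2. This is why the seminorm carries a cubic weight: it
controls an integral over the unbounded U₁ whatever the support. -/
theorem integrable_weight : Integrable (fun z : Rn 2 => (1 + ‖z‖) ^ (-3 : ℝ)) := by
  refine integrable_one_add_norm ?_
  simp
  norm_num

theorem integrableOn_expFun_mul {τ : ℝ} (hτ : 0 < τ) {c : GevreyClass}
    (hc : ContainedIn c (τ + 1)) {l : ℕ} {U : Opens (Rn 2)} (φ : testSpace c U)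
    (hφ : tsupport (φ : Rn 2 → ℂ) ⊆ U₁ l) :
    IntegrableOn (fun z => expFun τ l z * (φ : Rn 2 → ℂ) z) (U₁ l) := by
  refine Integrable.mono' (integrable_weight.const_mul
    ((8 * 2 ^ τ + Real.exp 1) * vertSeminorm hτ hc U φ)).integrableOn ?_ ?_
  · exact ((measurable_expFun τ l).mul φ.2.1.continuous.measurable).aestronglyMeasurable
  · exact (ae_restrict_iff' (U₁ l).isOpen.measurableSet).mpr
      (Eventually.of_forall fun z hz => norm_expFun_mul_le_vertSeminorm hτ hc φ hφ z hz)

/-- `expFun` defines a functional on the test functions supported in `U₁` which extends to an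
ultradistribution on the plane. -/
theorem exists_extension_expFun {τ : ℝ} (hτ : 0 < τ) {c : GevreyClass}
    (hc : ContainedIn c (τ + 1)) (l : ℕ) :
    ∃ T : ultradistributions c (⊤ : Opens (Rn 2)), ∀ φ : testSpace c (⊤ : Opens (Rn 2)),
      tsupport (φ : Rn 2 → ℂ) ⊆ U₁ l →
        (T : testSpace c (⊤ : Opens (Rn 2)) →ₗ[ℂ] ℂ) φ =
          ∫ z in (U₁ l : Set (Rn 2)), expFun τ l z * (φ : Rn 2 → ℂ) z := by
  set E := testSpace c (⊤ : Opens (Rn 2))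
  let S : Submodule ℂ E := (testSpace c (U₁ l)).comap E.subtype
  have hS : ∀ φ : S, tsupport ((φ : E) : Rn 2 → ℂ) ⊆ U₁ l := fun φ => φ.2.2.2.1
  let T₀ : S →ₗ[ℂ] ℂ :=
    { toFun := fun φ => ∫ z in (U₁ l : Set (Rn 2)), expFun τ l z * ((φ : E) : Rn 2 → ℂ) z
      map_add' := by
        intro φ ψ
        rw [← integral_add (integrableOn_expFun_mul hτ hc _ (hS φ))
          (integrableOn_expFun_mul hτ hc _ (hS ψ))]
        congr 1
        ext z
        simp [mul_add]
      map_smul' := by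
        intro a φ
        rw [RingHom.id_apply, smul_eq_mul, ← integral_const_mul]
        congr 1
        ext z
        simp only [Submodule.coe_smul, Pi.smul_apply, smul_eq_mul]
        ring }
  set D : ℝ := (8 * 2 ^ τ + Real.exp 1) * ∫ z : Rn 2, (1 + ‖z‖) ^ (-3 : ℝ)
  have hw : 0 ≤ ∫ z : Rn 2, (1 + ‖z‖) ^ (-3 : ℝ) := integral_nonneg fun z => by positivity
  have hD : 0 ≤ D := by positivity
  set p := vertSeminorm hτ hc (⊤ : Opens (Rn 2))
  let d : NNReal := ⟨D, hD⟩
  have hT₀ : ∀ φ : S, ‖T₀ φ‖ ≤ (d • p) (φ : E) := by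
    intro φ
    change ‖∫ z in (U₁ l : Set (Rn 2)), expFun τ l z * ((φ : E) : Rn 2 → ℂ) z‖ ≤ D * p (φ : E)
    calc _ ≤ ∫ z in (U₁ l : Set (Rn 2)),
          (8 * 2 ^ τ + Real.exp 1) * p φ * (1 + ‖z‖) ^ (-3 : ℝ) := by
          refine norm_integral_le_of_norm_le (integrable_weight.const_mul _).integrableOn ?_
          exact (ae_restrict_iff' (U₁ l).isOpen.measurableSet).mpr (Eventually.of_forall
            fun z hz => norm_expFun_mul_le_vertSeminorm hτ hc (φ : E) (hS φ) z hz)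
      _ ≤ ∫ z : Rn 2, (8 * 2 ^ τ + Real.exp 1) * p φ * (1 + ‖z‖) ^ (-3 : ℝ) := by
          refine setIntegral_le_integral (integrable_weight.const_mul _)
            (Eventually.of_forall fun z => ?_)
          have : 0 ≤ p φ := apply_nonneg p _
          positivity
      _ = _ := by rw [integral_const_mul]; ring
  -- Hahn–Banach: the seminorm is finite on all test functions of the plane, not only on those
  -- supported in U₁, and it dominates the extension too.
  obtain ⟨T, hTS, hTp⟩ := Module.Dual.exists_extension_of_le_seminorm S T₀ hT₀
  refine ⟨⟨T, ?_⟩, fun φ hφ => hTS ⟨φ, φ.2.1, φ.2.2.1, hφ, φ.2.2.2.2⟩⟩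
  refine isContinuousForm_of_containedIn hc (critRadius_pos hτ) fun K hK => ?_
  obtain ⟨R, hR⟩ := hK.isBounded.subset_closedBall 0
  refine ⟨D * (1 + |R|) ^ 3, fun φ hφ M hM => (hTp φ).trans ?_⟩
  change D * p φ ≤ _
  rw [mul_assoc D ((1 + |R|) ^ 3)]
  exact mul_le_mul_of_nonneg_left
    (vertSeminorm_le hτ hc φ (vertRatio_le hτ (hφ.trans hR) hM)) hD

/-! ### Local integrability -/

theorem integrableAtFilter_expFun {τ : ℝ} (hτ : 0 < τ) (l : ℕ) {z : Rn 2} (hz : z ∈ U₁ l) :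
    IntegrableAtFilter (expFun τ l) (𝓝 z) := by
  have hz' : 0 < z 1 - z 0 ^ (2 * l + 1) := sub_pos.mpr hz
  set a := z 1 - z 0 ^ (2 * l + 1)
  have hcont : Continuous fun p : Rn 2 => p 1 - p 0 ^ (2 * l + 1) := by fun_prop
  have hnhds : {p : Rn 2 | a / 2 < p 1 - p 0 ^ (2 * l + 1)} ∩ Metric.ball z 1 ∈ 𝓝 z :=
    inter_mem ((isOpen_lt continuous_const hcont).mem_nhds (by
      change a / 2 < a; linarith)) (Metric.ball_mem_nhds z one_pos)
  refine ⟨_, hnhds, ?_⟩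
  refine Measure.integrableOn_of_bounded (M := Real.exp ((a / 2) ^ (-(1 / τ)))) ?_
    (measurable_expFun τ l).aestronglyMeasurable ?_
  · exact ((measure_mono inter_subset_right).trans_lt measure_ball_lt_top).ne
  · refine (ae_restrict_iff' ?_).mpr (Eventually.of_forall fun p hp => ?_)
    · exact ((isOpen_lt continuous_const hcont).inter Metric.isOpen_ball).measurableSet
    · refine (norm_expFun_le τ l p).trans (Real.exp_le_exp.mpr ?_)
      have hp' : a / 2 < p 1 - p 0 ^ (2 * l + 1) := hp.1
      exact Real.rpow_le_rpow_of_nonpos (by positivity) hp'.le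
        (by rw [neg_nonpos]; positivity)

theorem locallyIntegrableOn_expFun {τ : ℝ} (hτ : 0 < τ) (l : ℕ) :
    LocallyIntegrableOn (expFun τ l) (U₁ l : Set (Rn 2)) := fun _ hz =>
  (integrableAtFilter_expFun hτ l hz).filter_mono nhdsWithin_le_nhds

theorem expFun_eq_zero {τ : ℝ} {l : ℕ} {z : Rn 2} (hz : z ∈ U₂) : expFun τ l z = 0 :=
  if_neg (not_lt.mpr (le_of_lt hz))

/-- The function equal to `expFun` on `U₁` and to `0` elsewhere is locally integrable on
`U₁ ∪ U₂`. -/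
theorem locallyIntegrableOn_indicator_expFun {τ : ℝ} (hτ : 0 < τ) (l : ℕ) :
    LocallyIntegrableOn ((U₁ l : Set (Rn 2)).indicator (expFun τ l))
      ((U₁ l ⊔ U₂ : Opens (Rn 2)) : Set (Rn 2)) := by
  intro z hz
  refine IntegrableAtFilter.filter_mono nhdsWithin_le_nhds ?_
  rcases hz with hz | hz
  · obtain ⟨s, hs, hi⟩ := integrableAtFilter_expFun hτ l hz
    exact ⟨s, hs, hi.indicator (U₁ l).isOpen.measurableSet⟩
  · refine ⟨U₂, U₂.isOpen.mem_nhds hz, ?_⟩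
    refine (integrableOn_congr_fun (g := fun _ => 0) (fun p hp => ?_)
      U₂.isOpen.measurableSet).mpr integrableOn_zero
    rw [indicator_apply_eq_zero]
    exact fun _ => expFun_eq_zero hp

/-! ### Products of functions of one variable as test functions -/

/-- The function `(x, y) ↦ f x * g y`. -/
def tensor (f g : ℝ → ℝ) (p : Rn 2) : ℂ := ((f (p 0) * g (p 1) : ℝ) : ℂ)

theorem contDiff_tensor {f g : ℝ → ℝ} (hf : ContDiff ℝ ∞ f) (hg : ContDiff ℝ ∞ g) :
    ContDiff ℝ ∞ (tensor f g) := by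
  have h : ∀ i, ContDiff ℝ ∞ fun p : Rn 2 => p i := fun i =>
    (EuclideanSpace.proj i : Rn 2 →L[ℝ] ℝ).contDiff
  exact Complex.ofRealCLM.contDiff.comp ((hf.comp (h 0)).mul (hg.comp (h 1)))

theorem norm_proj_le_one (i : Fin 2) : ‖(EuclideanSpace.proj i : Rn 2 →L[ℝ] ℝ)‖ ≤ 1 :=
  ContinuousLinearMap.opNorm_le_bound _ zero_le_one fun x => by
    simpa using PiLp.norm_apply_le x i

theorem hasGevreyBound_tensor {s A M N : ℝ} (hs : 0 ≤ s) (hA : 0 ≤ A) {f g : ℝ → ℝ}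
    (hf : ContDiff ℝ ∞ f) (hg : ContDiff ℝ ∞ g) (Hf : GevreyBounds s A M f)
    (Hg : GevreyBounds s A N g) : HasGevreyBound s (2 * A) (M * N) (tensor f g) := by
  have hproj : ∀ (i : Fin 2) {M : ℝ} {f : ℝ → ℝ}, ContDiff ℝ ∞ f → GevreyBounds s A M f →
      GevreyBounds s A M fun p : Rn 2 => f ((EuclideanSpace.proj i : Rn 2 →L[ℝ] ℝ) p) :=
    fun i M f hf Hf => (Hf.comp_clm hf (EuclideanSpace.proj i)).mono (by positivity)
      (mul_le_of_le_one_right hA (norm_proj_le_one i))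
  have hcd : ∀ (i : Fin 2) {f : ℝ → ℝ}, ContDiff ℝ ∞ f →
      ContDiff ℝ ∞ fun p : Rn 2 => f ((EuclideanSpace.proj i : Rn 2 →L[ℝ] ℝ) p) :=
    fun i f hf => hf.comp (ContinuousLinearMap.contDiff _)
  have H := (hproj 0 hf Hf).mul hs hA hA (hcd 0 hf) (hcd 1 hg) (hproj 1 hg Hg)
  intro k j x
  have h1 := Complex.ofRealLI.norm_iteratedFDeriv_comp_left (x := x)
    ((hcd 0 hf).mul (hcd 1 hg)).contDiffAt (natCast_le_infty k)
  have h2 : tensor f g = Complex.ofRealLI ∘ fun p : Rn 2 =>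
      f ((EuclideanSpace.proj 0 : Rn 2 →L[ℝ] ℝ) p) *
        g ((EuclideanSpace.proj 1 : Rn 2 →L[ℝ] ℝ) p) := rfl
  refine (ContinuousMultilinearMap.le_opNorm _ _).trans ?_
  rw [h2, h1]
  simpa [two_mul] using H k x

theorem tsupport_tensor_subset {f g : ℝ → ℝ} {a b a' b' : ℝ} (hf : ∀ x ∉ Icc a b, f x = 0)
    (hg : ∀ y ∉ Icc a' b', g y = 0) :
    tsupport (tensor f g) ⊆ {p | p 0 ∈ Icc a b ∧ p 1 ∈ Icc a' b'} := by
  refine closure_minimal (fun p hp => ?_) ?_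
  · by_contra hne
    refine hp ?_
    rw [mem_ofPred_eq, not_and_or] at hne
    rcases hne with h | h
    · simp [tensor, hf _ h]
    · simp [tensor, hg _ h]
  · exact (isClosed_Icc.preimage (by fun_prop : Continuous fun p : Rn 2 => p 0)).inter
      (isClosed_Icc.preimage (by fun_prop : Continuous fun p : Rn 2 => p 1))

theorem tensor_mem_testSpace {c : GevreyClass} {s A M N R : ℝ} (hs : 0 ≤ s) (hA : 0 < A)
    (hsc : s < c.order) {f g : ℝ → ℝ} (hf : ContDiff ℝ ∞ f) (hg : ContDiff ℝ ∞ g)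
    (Hf : GevreyBounds s A M f) (Hg : GevreyBounds s A N g) {U : Opens (Rn 2)}
    (hR : tsupport (tensor f g) ⊆ Metric.closedBall 0 R) (hU : tsupport (tensor f g) ⊆ U) :
    tensor f g ∈ testSpace c U := by
  refine ⟨contDiff_tensor hf hg,
    (isCompact_closedBall 0 R).of_isClosed_subset (isClosed_tsupport _) hR, hU, ?_⟩
  have H := hasGevreyBound_tensor hs hA.le hf hg Hf Hg
  cases c with
  | beurling σ => exact fun h hh => ⟨_, H.of_order_lt hsc (by positivity) hh⟩
  | roumieu σ => exact ⟨1, one_pos, _, H.of_order_lt hsc (by positivity) one_pos⟩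

/-! ### Non-existence of a common extension -/

/-- Supplies the final contradiction, with X = 1/ε: the larger power in the exponent beats the
smaller one and any polynomial factor. -/
theorem exists_mul_pow_mul_exp_lt {c₁ κ₁ p q : ℝ} (C κ₂ X₀ : ℝ) (n : ℕ) (hc : 0 < c₁)
    (hκ : 0 < κ₁) (hp : 0 < p) (hqp : q < p) :
    ∃ X ≥ X₀, C * X ^ n * Real.exp (κ₂ * X ^ q) < c₁ * Real.exp (κ₁ * X ^ p) := by
  have h1 : Tendsto (fun X : ℝ => |C| * ((X ^ p) ^ ((n : ℝ) / p) *
      Real.exp (-(κ₁ / 2) * X ^ p))) atTop (𝓝 0) := by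
    have := ((tendsto_rpow_mul_exp_neg_mul_atTop_nhds_zero ((n : ℝ) / p) (κ₁ / 2)
      (by positivity)).comp (tendsto_rpow_atTop hp)).const_mul |C|
    simpa only [mul_zero, Function.comp_def] using this
  have h2 : ∀ᶠ X : ℝ in atTop, 2 * |κ₂| / κ₁ ≤ X ^ (p - q) :=
    (tendsto_rpow_atTop (sub_pos.mpr hqp)).eventually_ge_atTop _
  obtain ⟨X, h1, h2, h3, h4⟩ := ((h1.eventually_lt_const hc).and
    (h2.and ((eventually_ge_atTop X₀).and (eventually_gt_atTop 0)))).exists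
  refine ⟨X, h3, ?_⟩
  rw [← Real.rpow_mul h4.le, mul_div_cancel₀ _ hp.ne', Real.rpow_natCast] at h1
  have h5 : κ₂ * X ^ q ≤ κ₁ / 2 * X ^ p := by
    have h6 : X ^ p = X ^ (p - q) * X ^ q := by rw [← Real.rpow_add h4, sub_add_cancel]
    rw [div_le_iff₀ hκ] at h2
    have hq : 0 < X ^ q := Real.rpow_pos_of_pos h4 q
    rw [h6, ← mul_assoc]
    refine mul_le_mul_of_nonneg_right ?_ hq.le
    linarith [le_abs_self κ₂]
  calc C * X ^ n * Real.exp (κ₂ * X ^ q)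
      ≤ |C| * X ^ n * Real.exp (κ₁ / 2 * X ^ p) := by
        gcongr
        exact le_abs_self C
    _ = |C| * (X ^ n * Real.exp (-(κ₁ / 2) * X ^ p)) * Real.exp (κ₁ * X ^ p) := by
        have : κ₁ / 2 * X ^ p = -(κ₁ / 2) * X ^ p + κ₁ * X ^ p := by ring
        rw [this, Real.exp_add]
        ring
    _ < c₁ * Real.exp (κ₁ * X ^ p) := by gcongr

/-- A weak consequence common to both kinds of continuity; one radius is enough to refute gluing. -/
theorem exists_boundedOn_of_isContinuousForm {n : ℕ} {c : GevreyClass} {U : Opens (Rn n)}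
    {T : testSpace c U →ₗ[ℂ] ℂ} (hT : IsContinuousForm T) {K : Set (Rn n)} (hK : IsCompact K)
    (hKU : K ⊆ U) : ∃ h : ℝ, 0 < h ∧ ∃ C, BoundedOn T K c.order h C := by
  have H := hT K hK hKU
  cases c with
  | beurling s => exact H
  | roumieu s => exact ⟨1, one_pos, H 1 one_pos⟩

/-- The open unit disc. -/
def unitDisc : Opens (Rn 2) := ⟨Metric.ball 0 1, Metric.isOpen_ball⟩

/-- A lower bound for the integral of `expFun` against a non-negative product function which is
large on a disc near `(-3 ε / 2, 0)`. -/
theorem le_setIntegral_expFun_mul_tensor {τ ε β : ℝ} (hτ : 0 < τ) (l : ℕ) (hε : 0 < ε)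
    (hε1 : ε ≤ 1) (hβ : 0 ≤ β) {f g : ℝ → ℝ} (hf0 : ∀ x, 0 ≤ f x) (hg0 : ∀ y, 0 < y → 0 ≤ g y)
    (hf : ∀ x, |x + 3 / 2 * ε| < ε / 4 → β ≤ f x) (hg : ∀ y, 0 < y → y < ε → g y = 1)
    (hi : IntegrableOn (fun z => expFun τ l z * tensor f g z) (U₁ l)) :
    β * Real.exp (((3 * ε) ^ (2 * l + 1)) ^ (-(1 / τ))) *
      ((ε ^ (2 * l + 1) / 4) ^ 2 * volume.real (Metric.ball (0 : Rn 2) 1)) ≤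
      ‖∫ z in (U₁ l : Set (Rn 2)), expFun τ l z * tensor f g z‖ := by
  set m := 2 * l + 1 with hm
  have hmodd : Odd m := ⟨l, hm⟩
  set w : Rn 2 → ℝ := fun p =>
    (if 0 < p 1 then Real.exp ((p 1 - p 0 ^ m) ^ (-(1 / τ))) else 0) * (f (p 0) * g (p 1))
  have hw : ∀ p, expFun τ l p * tensor f g p = ((w p : ℝ) : ℂ) := by
    intro p
    simp only [expFun, tensor, w, ← hm]
    split_ifs <;> simp
  have hw0 : ∀ p, 0 ≤ w p := by
    intro p
    simp only [w]
    split_ifs with h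
    · exact mul_nonneg (Real.exp_pos _).le (mul_nonneg (hf0 _) (hg0 _ h))
    · simp
  have hwi : IntegrableOn w (U₁ l) := by
    have : IntegrableOn (fun z => (expFun τ l z * tensor f g z).re) (U₁ l) := Integrable.re hi
    simpa only [hw, Complex.ofReal_re] using this
  simp only [hw]
  rw [integral_complex_ofReal]
  refine le_trans ?_ (le_of_eq_of_le rfl (Complex.norm_real _).ge)
  refine le_trans ?_ (Real.le_norm_self _)
  have hεm : 0 < ε ^ m := by positivity
  have hεmε : ε ^ m ≤ ε := pow_le_of_le_one hε.le hε1 (by omega)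
  -- The disc of radius ε^m/4 about this point lies in x < 0 < y < ε^m, hence inside U₁ and where
  -- `expFun` is not cut off.
  set z₀ : Rn 2 := !₂[-(3 / 2 * ε), ε ^ m / 2]
  set D := Metric.ball z₀ (ε ^ m / 4)
  have hD : ∀ p ∈ D, |p 0 + 3 / 2 * ε| < ε ^ m / 4 ∧ |p 1 - ε ^ m / 2| < ε ^ m / 4 := by
    intro p hp
    rw [Metric.mem_ball, dist_eq_norm] at hp
    have h0 := (PiLp.norm_apply_le (p - z₀) 0).trans_lt hp
    have h1 := (PiLp.norm_apply_le (p - z₀) 1).trans_lt hp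
    simpa [z₀, Real.norm_eq_abs] using And.intro h0 h1
  have hcoord : ∀ p ∈ D, 0 < p 1 ∧ p 1 < ε ^ m ∧ p 0 < 0 ∧ -(2 * ε) ≤ p 0 := by
    intro p hp
    obtain ⟨h0, h1⟩ := hD p hp
    rw [abs_lt] at h0 h1
    refine ⟨?_, ?_, ?_, ?_⟩ <;> linarith
  have hDU : D ⊆ U₁ l := by
    intro p hp
    obtain ⟨h1, _, h3, _⟩ := hcoord p hp
    exact (hmodd.pow_neg h3).trans h1
  have hDvol : volume.real D = (ε ^ m / 4) ^ 2 * volume.real (Metric.ball (0 : Rn 2) 1) := by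
    rw [Measure.real, Measure.addHaar_ball _ _ (by positivity), ENNReal.toReal_mul,
      ENNReal.toReal_ofReal (by positivity), finrank_euclideanSpace_fin, Measure.real]
  rw [← hDvol]
  refine (setIntegral_ge_of_const_le_real measurableSet_ball measure_ball_lt_top.ne ?_
    (hwi.mono_set hDU)).trans (setIntegral_mono_set hwi (Eventually.of_forall hw0)
      (LE.le.eventuallyLE hDU))
  intro p hp
  obtain ⟨h1, h2, h3, h4⟩ := hcoord p hp
  -- Since -2ε ≤ x < 0 and y < ε^m, superadditivity of the m-th power applies.
  have ht : p 1 - p 0 ^ m ≤ (3 * ε) ^ m := by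
    have h5 : -(p 0 ^ m) = (-(p 0)) ^ m := (hmodd.neg_pow _).symm
    have h6 : (-(p 0)) ^ m ≤ (2 * ε) ^ m := pow_le_pow_left₀ (by linarith) (by linarith) m
    have h7 : ε ^ m + (2 * ε) ^ m ≤ (ε + 2 * ε) ^ m :=
      pow_add_pow_le hε.le (by positivity) (by omega)
    rw [show 3 * ε = ε + 2 * ε by ring]
    linarith
  have ht0 : 0 < p 1 - p 0 ^ m := sub_pos.mpr (hDU hp)
  have hfp := hf (p 0) ((hD p hp).1.trans_le (by linarith))
  have hgp := hg (p 1) h1 (by linarith)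
  simp only [if_pos h1, hgp, mul_one]
  rw [mul_comm]
  refine mul_le_mul (Real.exp_le_exp.mpr ?_) hfp hβ (Real.exp_pos _).le
  exact Real.rpow_le_rpow_of_nonpos ht0 ht (by rw [neg_nonpos]; positivity)

theorem exists_odd_one_div_lt {δ : ℝ} (hδ : 0 < δ) : ∃ N : ℕ, Odd N ∧ 1 / (N : ℝ) < δ := by
  obtain ⟨n, hn⟩ := exists_nat_one_div_lt hδ
  refine ⟨2 * n + 1, ⟨n, rfl⟩, lt_of_le_of_lt ?_ hn⟩
  push_cast
  gcongr
  linarith [(Nat.cast_nonneg n : (0 : ℝ) ≤ n)]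

theorem tensor_add (f g₁ g₂ : ℝ → ℝ) :
    tensor f g₁ + tensor f g₂ = tensor f (fun y => g₁ y + g₂ y) := by
  ext p
  simp [tensor, mul_add]

/-- No ultradistribution on the plane restricts to `expFun` on `U₁` and to `0` on `U₂`, even inside
the unit disc, as soon as `τ < (2 l + 1) (s - 1)`. -/
theorem not_exists_gluing {τ : ℝ} (hτ : 0 < τ) {c : GevreyClass} (hc : ContainedIn c (τ + 1))
    {l : ℕ} (hl : τ < (2 * l + 1) * (c.order - 1))
    (T : ultradistributions c (⊤ : Opens (Rn 2)))
    (h₁ : ∀ φ : testSpace c (⊤ : Opens (Rn 2)),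
      tsupport (φ : Rn 2 → ℂ) ⊆ (U₁ l ⊓ unitDisc : Opens (Rn 2)) →
        (T : testSpace c (⊤ : Opens (Rn 2)) →ₗ[ℂ] ℂ) φ =
          ∫ z in (U₁ l : Set (Rn 2)), expFun τ l z * (φ : Rn 2 → ℂ) z)
    (h₂ : ∀ φ : testSpace c (⊤ : Opens (Rn 2)),
      tsupport (φ : Rn 2 → ℂ) ⊆ (U₂ ⊓ unitDisc : Opens (Rn 2)) →
        (T : testSpace c (⊤ : Opens (Rn 2)) →ₗ[ℂ] ℂ) φ = 0) : False := by
  set m : ℕ := 2 * l + 1 with hm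
  have hmodd : Odd m := ⟨l, hm⟩
  have hmR : (m : ℝ) = 2 * l + 1 := by rw [hm]; push_cast; ring
  have hm0 : (0 : ℝ) < m := by rw [hmR]; positivity
  rw [← hmR] at hl
  have hgap : 0 < (c.order - 1) - τ / m := by
    rw [sub_pos, div_lt_iff₀ hm0]; linarith
  -- N is so large that cutoffs of order s' = 1 + 1/N still leave a gap ρ = s - s' above τ/m.
  obtain ⟨N, hN, hNlt⟩ := exists_odd_one_div_lt hgap
  set s' : ℝ := 1 + 1 / (N : ℝ) with hs'
  have hs'0 : 0 ≤ s' := by positivity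
  set ρ : ℝ := c.order - s' with hρdef
  have hρτ : τ / m < ρ := by rw [hρdef, hs']; linarith
  have hρ : 0 < ρ := (by positivity : 0 < τ / m).trans hρτ
  have hsc : s' < c.order := sub_pos.mp hρ
  obtain ⟨A, M, b, H, hA, hM, hbs, hbG, hb0, hbpos, hbz, hHs, hHG, hHnn, hHle, hH0, hH1⟩ :=
    exists_gevrey_bump_and_step hN
  obtain ⟨h, hh, C, hC⟩ := exists_boundedOn_of_isContinuousForm T.2
    (isCompact_closedBall (0 : Rn 2) 1) (subset_univ _)
  obtain ⟨β, hβ, hβb⟩ : ∃ β, 0 < β ∧ ∀ t ∈ Icc (1 / 4 : ℝ) (3 / 4), β ≤ b t := by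
    obtain ⟨t₀, ht₀, hmin⟩ := isCompact_Icc.exists_isMinOn
      (nonempty_Icc.mpr (by norm_num : (1 / 4 : ℝ) ≤ 3 / 4)) hbs.continuous.continuousOn
    exact ⟨b t₀, hbpos t₀ ⟨by linarith [ht₀.1], by linarith [ht₀.2]⟩, fun t ht => hmin ht⟩
  set v := volume.real (Metric.ball (0 : Rn 2) 1) with hv
  have hv0 : 0 < v := ENNReal.toReal_pos (Metric.measure_ball_pos _ _ one_pos).ne'
    measure_ball_lt_top.ne
  have key : ∀ ε : ℝ, 0 < ε → ε ≤ 1 / 8 →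
      β * Real.exp (((3 * ε) ^ m) ^ (-(1 / τ))) * ((ε ^ m / 4) ^ 2 * v) ≤
        |C| * (Real.exp (ρ * ((2 * (A * |1 / ε|)) / h) ^ (1 / ρ)) * (M * (M + M))) := by
    intro ε hε hε8
    -- For x ≤ -ε the strip -2δ ≤ y ≤ -δ, where `hr` makes its transition, lies in the overlap,
    -- because x^m ≤ -ε^m = -4δ.
    set δ : ℝ := ε ^ m / 4 with hδdef
    have hεm : 0 < ε ^ m := by positivity
    have hεmε : ε ^ m ≤ ε := pow_le_of_le_one hε.le (by linarith) (by omega)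
    have hδ : 0 < δ := by positivity
    have hδε : δ ≤ ε := by rw [hδdef]; linarith
    have hsc1 : ∀ (r : ℝ), 0 < r → ∀ y a : ℝ, 1 / r * y + a = (y + a * r) / r := by
      intro r hr y a; field_simp
    have hG : ∀ (r : ℝ) (a : ℝ) {f : ℝ → ℝ}, ContDiff ℝ ∞ f → GevreyBounds s' A M f →
        ContDiff ℝ ∞ (fun x => f (1 / r * x + a)) ∧
        GevreyBounds s' (A * |1 / r|) M (fun x => f (1 / r * x + a)) := fun r a f hf Hf =>
      ⟨hf.comp ((contDiff_const.mul contDiff_id).add contDiff_const), Hf.comp_affine hf _ _⟩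
    obtain ⟨hfs, hfG⟩ := hG ε 2 hbs hbG
    obtain ⟨hps, hpG⟩ := hG ε 2 hHs hHG
    obtain ⟨hqs, hqG⟩ := hG ε (-1) hHs hHG
    obtain ⟨hrs, hrG⟩ := hG δ 2 hHs hHG
    set f : ℝ → ℝ := fun x => b (1 / ε * x + 2)
    set hp : ℝ → ℝ := fun y => H (1 / ε * y + 2)
    set hq : ℝ → ℝ := fun y => H (1 / ε * y + -1)
    set hr : ℝ → ℝ := fun y => H (1 / δ * y + 2)
    have hf0 : ∀ x ∉ Icc (-(2 * ε)) (-ε), f x = 0 := by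
      intro x hx
      refine hbz _ fun hmem => hx ?_
      rw [hsc1 ε hε, mem_Ioo, lt_div_iff₀ hε, div_lt_iff₀ hε] at hmem
      constructor <;> linarith
    have hp1 : ∀ y, -ε ≤ y → hp y = 1 := by
      intro y hy
      refine hH1 _ ?_
      rw [hsc1 ε hε, le_div_iff₀ hε]; linarith
    have hp0 : ∀ y, y ≤ -(2 * ε) → hp y = 0 := by
      intro y hy
      refine hH0 _ ?_
      rw [hsc1 ε hε, div_le_iff₀ hε]; linarith
    have hq1 : ∀ y, 2 * ε ≤ y → hq y = 1 := by
      intro y hy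
      refine hH1 _ ?_
      rw [hsc1 ε hε, le_div_iff₀ hε]; linarith
    have hq0 : ∀ y, y ≤ ε → hq y = 0 := by
      intro y hy
      refine hH0 _ ?_
      rw [hsc1 ε hε, div_le_iff₀ hε]; linarith
    have hr1 : ∀ y, -δ ≤ y → hr y = 1 := by
      intro y hy
      refine hH1 _ ?_
      rw [hsc1 δ hδ, le_div_iff₀ hδ]; linarith
    have hr0 : ∀ y, y ≤ -(2 * δ) → hr y = 0 := by
      intro y hy
      refine hH0 _ ?_
      rw [hsc1 δ hδ, div_le_iff₀ hδ]; linarith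
    -- A crude radius, used only to see that both pieces are test functions; it enters no estimate.
    set B : ℝ := max (A * |1 / ε|) (A * |1 / δ|)
    have hAε : 0 < A * |1 / ε| := by positivity
    have hAδ : 0 < A * |1 / δ| := by positivity
    have hB : 0 < B := lt_max_of_lt_left hAε
    have hsub1 : tsupport (tensor f fun y => hr y - hq y) ⊆
        {p | p 0 ∈ Icc (-(2 * ε)) (-ε) ∧ p 1 ∈ Icc (-(2 * δ)) (2 * ε)} := by
      refine tsupport_tensor_subset hf0 fun y hy => ?_
      rw [mem_Icc, not_and_or, not_le, not_le] at hy
      rcases hy with hy | hy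
      · rw [hr0 y hy.le, hq0 y (by linarith), sub_zero]
      · rw [hr1 y (by linarith), hq1 y hy.le, sub_self]
    have hsub2 : tsupport (tensor f fun y => hp y - hr y) ⊆
        {p | p 0 ∈ Icc (-(2 * ε)) (-ε) ∧ p 1 ∈ Icc (-(2 * ε)) (-δ)} := by
      refine tsupport_tensor_subset hf0 fun y hy => ?_
      rw [mem_Icc, not_and_or, not_le, not_le] at hy
      rcases hy with hy | hy
      · rcases le_or_gt y (-(2 * δ)) with hy' | hy'
        · rw [hp0 y hy.le, hr0 y hy', sub_zero]
        · exfalso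
          linarith
      · rw [hp1 y (by linarith), hr1 y hy.le, sub_self]
    have hsub3 : tsupport (tensor f fun y => hp y - hq y) ⊆
        {p | p 0 ∈ Icc (-(2 * ε)) (-ε) ∧ p 1 ∈ Icc (-(2 * ε)) (2 * ε)} := by
      refine tsupport_tensor_subset hf0 fun y hy => ?_
      rw [mem_Icc, not_and_or, not_le, not_le] at hy
      rcases hy with hy | hy
      · rw [hp0 y hy.le, hq0 y (by linarith), sub_zero]
      · rw [hp1 y (by linarith), hq1 y hy.le, sub_self]
    have hbox : ∀ p : Rn 2, p 0 ∈ Icc (-(2 * ε)) (-ε) → p 1 ∈ Icc (-(2 * ε)) (2 * ε) →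
        p ∈ Metric.ball (0 : Rn 2) 1 := by
      intro p hp0 hp1
      rw [mem_ball_zero_iff, EuclideanSpace.norm_eq, Fin.sum_univ_two, Real.sqrt_lt' one_pos,
        Real.norm_eq_abs, Real.norm_eq_abs, sq_abs, sq_abs]
      have e0 : p 0 ^ 2 ≤ (2 * ε) ^ 2 := sq_le_sq' hp0.1 (by linarith [hp0.2])
      have e1 : p 1 ^ 2 ≤ (2 * ε) ^ 2 := sq_le_sq' hp1.1 hp1.2
      nlinarith
    have hin1 : tsupport (tensor f fun y => hr y - hq y) ⊆
        (U₁ l ⊓ unitDisc : Opens (Rn 2)) := by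
      intro p hp
      obtain ⟨hx, hy⟩ := hsub1 hp
      refine ⟨?_, hbox p hx ⟨by linarith [hy.1], hy.2⟩⟩
      change p 0 ^ m < p 1
      have h5 : -(p 0 ^ m) = (-(p 0)) ^ m := (hmodd.neg_pow _).symm
      have h6 : ε ^ m ≤ (-(p 0)) ^ m := pow_le_pow_left₀ hε.le (by linarith [hx.2]) m
      have := hy.1
      rw [hδdef] at this
      linarith
    have hin2 : tsupport (tensor f fun y => hp y - hr y) ⊆
        (U₂ ⊓ unitDisc : Opens (Rn 2)) := by
      intro p hp
      obtain ⟨hx, hy⟩ := hsub2 hp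
      refine ⟨?_, hbox p hx ⟨hy.1, by linarith [hy.2]⟩⟩
      change p 1 < 0
      linarith [hy.2]
    have hball1 := hin1.trans (inter_subset_right.trans Metric.ball_subset_closedBall)
    have hball2 := hin2.trans (inter_subset_right.trans Metric.ball_subset_closedBall)
    have hball3 : tsupport (tensor f fun y => hp y - hq y) ⊆ Metric.closedBall (0 : Rn 2) 1 :=
      fun p hp => Metric.ball_subset_closedBall (hbox p (hsub3 hp).1 (hsub3 hp).2)
    have hfB := hfG.mono hAε.le (le_max_left _ _ : _ ≤ B)
    have hpB := hpG.mono hAε.le (le_max_left _ _ : _ ≤ B)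
    have hqB := hqG.mono hAε.le (le_max_left _ _ : _ ≤ B)
    have hrB := hrG.mono hAδ.le (le_max_right _ _ : _ ≤ B)
    let φ₁ : testSpace c (⊤ : Opens (Rn 2)) := ⟨tensor f fun y => hr y - hq y,
      tensor_mem_testSpace hs'0 hB hsc hfs (hrs.sub hqs) hfB (hrB.sub hrs hqs hqB) hball1
        (subset_univ _)⟩
    let φ₂ : testSpace c (⊤ : Opens (Rn 2)) := ⟨tensor f fun y => hp y - hr y,
      tensor_mem_testSpace hs'0 hB hsc hfs (hps.sub hrs) hfB (hpB.sub hps hrs hrB) hball2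
        (subset_univ _)⟩
    have hsum : ((φ₁ + φ₂ : testSpace c (⊤ : Opens (Rn 2))) : Rn 2 → ℂ) =
        tensor f fun y => hp y - hq y := by
      rw [Submodule.coe_add, tensor_add]
      congr 1
      ext y
      ring
    -- The cutoff `hr` at scale δ has cancelled in the sum, so the radius here is of size 1/ε only.
    have hGB := (hasGevreyBound_tensor hs'0 hAε.le hfs (hps.sub hqs) hfG
      (hpG.sub hps hqs hqG)).of_order_lt hsc (by positivity) hh
    have hT := hC (φ₁ + φ₂) (by rw [hsum]; exact hball3) _ (by rw [hsum]; exact hGB)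
    rw [map_add, h₂ φ₂ hin2, add_zero, h₁ φ₁ hin1] at hT
    have hi := integrableOn_expFun_mul hτ hc φ₁ (hin1.trans inter_subset_left)
    refine (le_setIntegral_expFun_mul_tensor hτ l hε (by linarith) hβ.le (f := f)
      (g := fun y => hr y - hq y) (fun x => hb0 _) ?_ ?_ ?_ hi).trans (hT.trans ?_)
    · intro y hy
      rw [hr1 y (by linarith)]
      linarith [hHle (1 / ε * y + -1)]
    · intro x hx
      rw [abs_lt] at hx
      refine hβb _ ?_
      rw [hsc1 ε hε, mem_Icc, le_div_iff₀ hε, div_le_iff₀ hε]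
      constructor <;> linarith
    · intro y hy hyε
      rw [hr1 y (by linarith), hq0 y hyε.le, sub_zero]
    · refine mul_le_mul_of_nonneg_right (le_abs_self C) ?_
      exact hGB.nonneg
  have hq' : 1 / ρ < m / τ := by
    rw [div_lt_div_iff₀ hρ hτ, one_mul]
    rw [div_lt_iff₀ hm0] at hρτ
    linarith
  -- X is 1/ε, with X ≥ 8 for ε ≤ 1/8; the 16 and X^(2m) come from the disc area (ε^m/4)^2 v.
  obtain ⟨X, hX8, hX⟩ := exists_mul_pow_mul_exp_lt (c₁ := β * (v / 16))
    (κ₁ := ((3 : ℝ) ^ m) ^ (-(1 / τ))) (p := m / τ) (q := 1 / ρ) (|C| * (M * (M + M)))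
    (ρ * (2 * A / h) ^ (1 / ρ)) 8 (2 * m) (by positivity) (by positivity) (by positivity) hq'
  have hX0 : 0 < X := by linarith
  have hk := key X⁻¹ (by positivity) (by
    rw [inv_le_comm₀ hX0 (by norm_num)]; linarith)
  have e1 : ((3 * X⁻¹) ^ m) ^ (-(1 / τ)) = ((3 : ℝ) ^ m) ^ (-(1 / τ)) * X ^ ((m : ℝ) / τ) := by
    rw [mul_pow, Real.mul_rpow (by positivity) (by positivity)]
    congr 1
    rw [inv_pow, Real.inv_rpow (by positivity), ← Real.rpow_neg (by positivity), neg_neg,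
      ← Real.rpow_natCast, ← Real.rpow_mul hX0.le, mul_one_div]
  have e2 : ρ * (2 * (A * |1 / X⁻¹|) / h) ^ (1 / ρ) =
      ρ * (2 * A / h) ^ (1 / ρ) * X ^ (1 / ρ) := by
    rw [one_div X⁻¹, inv_inv, abs_of_pos hX0, mul_assoc ρ, ← Real.mul_rpow (by positivity) hX0.le]
    congr 2
    ring
  rw [e1, e2] at hk
  refine absurd hk (not_le.mpr ?_)
  have hX2 : 0 < X ^ (2 * m) := by positivity
  rw [← mul_lt_mul_iff_left₀ hX2]
  calc _ = |C| * (M * (M + M)) * X ^ (2 * m) *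
        Real.exp (ρ * (2 * A / h) ^ (1 / ρ) * X ^ (1 / ρ)) := by ring
    _ < _ := hX
    _ = _ := by
      rw [div_pow, ← pow_mul, mul_comm m 2, inv_pow]
      field_simp
      norm_num

/-! ### The subanalytic site -/

/-- The auxiliary manifold is taken to be a point, so the projection loses nothing. -/
theorem isSubanalytic_of_isSemianalytic {n : ℕ} {Z : Set (Rn n)} (hZ : IsCompact (closure Z))
    (hsa : IsSemianalytic ((𝓡 n).prod (𝓡 0)) (Prod.fst ⁻¹' Z : Set (Rn n × Rn 0))) :
    IsSubanalytic Z := by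
  intro x
  refine ⟨univ, isOpen_univ, mem_univ x, 0, Rn 0, inferInstance, inferInstance, inferInstance,
    inferInstance, inferInstance, Prod.fst ⁻¹' Z, ?_, hsa, ?_⟩
  · refine (hZ.prod isCompact_univ).of_isClosed_subset isClosed_closure
      (closure_minimal (fun q hq => ⟨subset_closure hq, mem_univ _⟩) ?_)
    exact (isClosed_closure).prod isClosed_univ
  · rw [inter_univ, image_preimage_eq _ Prod.fst_surjective]

theorem isSubanalytic_of_eq {n : ℕ} {Z : Set (Rn n)} (hZ : IsCompact (closure Z)) (p q : ℕ)
    (f : Fin p → Fin q → Rn n → ℝ) (hf : ∀ i j, ContDiff ℝ ω (f i j))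
    (h : Z = {y | ∃ i, ∀ j, 0 < f i j y}) : IsSubanalytic Z := by
  refine isSubanalytic_of_isSemianalytic hZ fun x => ⟨univ, isOpen_univ, mem_univ x, p, q,
    fun i j y => f i j y.1, fun _ _ => true, fun i j => ?_, ?_⟩
  · exact ((hf i j).contMDiff.comp contMDiff_fst).contMDiffOn
  · subst h
    ext y
    simp

theorem isCompact_closure_of_le_unitDisc {U : Opens (Rn 2)} (hU : U ≤ unitDisc) :
    IsCompact (closure (U : Set (Rn 2))) :=
  (Metric.isBounded_ball.subset hU).isCompact_closure

theorem mem_unitDisc_iff (p : Rn 2) : p ∈ unitDisc ↔ 0 < 1 - (p 0 ^ 2 + p 1 ^ 2) := by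
  change p ∈ Metric.ball 0 1 ↔ _
  rw [mem_ball_zero_iff, EuclideanSpace.norm_eq, Fin.sum_univ_two, Real.sqrt_lt' one_pos,
    Real.norm_eq_abs, Real.norm_eq_abs, sq_abs, sq_abs, one_pow, sub_pos]

theorem contDiff_coord (i : Fin 2) : ContDiff ℝ ω fun p : Rn 2 => p i :=
  (EuclideanSpace.proj i : Rn 2 →L[ℝ] ℝ).contDiff

theorem isSaOpen_U₁_inf (l : ℕ) : IsSaOpen (U₁ l ⊓ unitDisc) := by
  have hK := isCompact_closure_of_le_unitDisc (inf_le_right : U₁ l ⊓ unitDisc ≤ unitDisc)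
  have h0 := contDiff_coord 0
  have h1 := contDiff_coord 1
  refine ⟨hK, isSubanalytic_of_eq hK 1 2
    ![![fun p => p 1 - p 0 ^ (2 * l + 1), fun p => 1 - (p 0 ^ 2 + p 1 ^ 2)]] ?_ ?_⟩
  · simp only [Fin.forall_fin_one, Fin.forall_fin_two]
    exact ⟨h1.sub (h0.pow _), contDiff_const.sub ((h0.pow 2).add (h1.pow 2))⟩
  · ext p
    simp only [Fin.exists_fin_one, Fin.forall_fin_two]
    exact and_congr (sub_pos (a := p 1)).symm (mem_unitDisc_iff p)

theorem isSaOpen_U₂_inf : IsSaOpen (U₂ ⊓ unitDisc) := by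
  have hK := isCompact_closure_of_le_unitDisc (inf_le_right : U₂ ⊓ unitDisc ≤ unitDisc)
  have h0 := contDiff_coord 0
  have h1 := contDiff_coord 1
  refine ⟨hK, isSubanalytic_of_eq hK 1 2
    ![![fun p => -p 1, fun p => 1 - (p 0 ^ 2 + p 1 ^ 2)]] ?_ ?_⟩
  · simp only [Fin.forall_fin_one, Fin.forall_fin_two]
    exact ⟨h1.neg, contDiff_const.sub ((h0.pow 2).add (h1.pow 2))⟩
  · ext p
    simp only [Fin.exists_fin_one, Fin.forall_fin_two]
    exact and_congr (neg_pos (a := p 1)).symm (mem_unitDisc_iff p)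

theorem isSaOpen_sup_inf (l : ℕ) : IsSaOpen (U₁ l ⊓ unitDisc ⊔ U₂ ⊓ unitDisc) := by
  have hK := isCompact_closure_of_le_unitDisc
    (sup_le inf_le_right inf_le_right : U₁ l ⊓ unitDisc ⊔ U₂ ⊓ unitDisc ≤ unitDisc)
  have h0 := contDiff_coord 0
  have h1 := contDiff_coord 1
  refine ⟨hK, isSubanalytic_of_eq hK 2 2
    ![![fun p => p 1 - p 0 ^ (2 * l + 1), fun p => 1 - (p 0 ^ 2 + p 1 ^ 2)],
      ![fun p => -p 1, fun p => 1 - (p 0 ^ 2 + p 1 ^ 2)]] ?_ ?_⟩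
  · have h2 : ContDiff ℝ ω fun p : Rn 2 => 1 - (p 0 ^ 2 + p 1 ^ 2) :=
      contDiff_const.sub ((h0.pow 2).add (h1.pow 2))
    simp only [Fin.forall_fin_two]
    exact ⟨⟨h1.sub (h0.pow _), h2⟩, ⟨h1.neg, h2⟩⟩
  · ext p
    simp only [Fin.exists_fin_two, Fin.forall_fin_two]
    exact or_congr (and_congr (sub_pos (a := p 1)).symm (mem_unitDisc_iff p))
      (and_congr (neg_pos (a := p 1)).symm (mem_unitDisc_iff p))

theorem isSaCovering_pair {n : ℕ} {V W : Opens (Rn n)} (hV : IsSaOpen V) (hW : IsSaOpen W) :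
    IsSaCovering (V ⊔ W) {V, W} := by
  refine ⟨?_, fun K _ => ⟨{V, W}, subset_rfl, toFinite _, ?_⟩⟩
  · rintro U (rfl | rfl)
    · exact ⟨hV, le_sup_left⟩
    · exact ⟨hW, le_sup_right⟩
  · rw [biUnion_pair]
    rfl

/-! ### Tempered ultradistributions through global representatives -/

/-- Reduces equality of sections and of their restrictions to global representatives, since
`temperedRestrict` keeps the representative. -/
theorem mk_eq_mk_iff {n : ℕ} {c : GevreyClass} {V : Opens (Rn n)}
    {T T' : ultradistributions c (⊤ : Opens (Rn n))} :
    (Submodule.Quotient.mk T : Tempered c V) = Submodule.Quotient.mk T' ↔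
      ∀ φ : testSpace c (⊤ : Opens (Rn n)), tsupport (φ : Rn n → ℂ) ⊆ V →
        (T : testSpace c (⊤ : Opens (Rn n)) →ₗ[ℂ] ℂ) φ =
          (T' : testSpace c (⊤ : Opens (Rn n)) →ₗ[ℂ] ℂ) φ := by
  rw [Submodule.Quotient.eq, supportedOff, LinearMap.mem_ker, map_sub, sub_eq_zero]
  constructor
  · intro h φ hφ
    exact congrArg (fun S : ultradistributions c V => (S : testSpace c V →ₗ[ℂ] ℂ)
      ⟨φ, φ.2.1, φ.2.2.1, hφ, φ.2.2.2.2⟩) h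
  · intro h
    refine Subtype.ext (LinearMap.ext fun φ => ?_)
    exact h (Submodule.inclusion (testSpace_mono c le_top) φ) φ.2.2.2.1

theorem isGivenBy_mk_iff {n : ℕ} {c : GevreyClass} {U : Opens (Rn n)}
    {T : ultradistributions c (⊤ : Opens (Rn n))} {f : Rn n → ℂ} :
    Tempered.IsGivenBy (Submodule.Quotient.mk T : Tempered c U) f ↔
      LocallyIntegrableOn f (U : Set (Rn n)) ∧
        ∀ φ : testSpace c (⊤ : Opens (Rn n)), tsupport (φ : Rn n → ℂ) ⊆ U →
          (T : testSpace c (⊤ : Opens (Rn n)) →ₗ[ℂ] ℂ) φ =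
            ∫ x in (U : Set (Rn n)), f x * (φ : Rn n → ℂ) x := by
  refine and_congr Iff.rfl ⟨fun h φ hφ => h ⟨φ, φ.2.1, φ.2.2.1, hφ, φ.2.2.2.2⟩, fun h φ => ?_⟩
  exact h (Submodule.inclusion (testSpace_mono c le_top) φ) φ.2.2.2.1

theorem setIntegral_expFun_eq_zero {τ : ℝ} {l : ℕ} {φ : Rn 2 → ℂ} (hφ : tsupport φ ⊆ U₂) :
    ∫ z in (U₁ l : Set (Rn 2)), expFun τ l z * φ z = 0 := by
  rw [integral_congr_ae (g := fun _ => 0) (Eventually.of_forall fun z => ?_), integral_zero]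
  by_cases hz : z ∈ tsupport φ
  · simp [expFun_eq_zero (hφ hz)]
  · simp [image_eq_zero_of_notMem_tsupport hz]

/-! ### The two assertions of the theorem -/

theorem expFun_one (l : ℕ) : expFun 1 l = u₁ l := by
  ext p
  simp only [expFun, u₁, div_one, Real.rpow_neg_one, one_div]

theorem containedIn_beurling_two : ContainedIn (.beurling 2) (1 + 1) :=
  Or.inl (by norm_num)

theorem gluing_fails_on_U₁_sup_U₂ (l : ℕ) (hl : 1 ≤ l) :
    ∃ (t₁ : Tempered (.beurling 2) (U₁ l)) (t₂ : Tempered (.beurling 2) U₂),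
      t₁.IsGivenBy (u₁ l) ∧ t₂.IsGivenBy u₂ ∧
      Set.EqOn (u₁ l) u₂ (U₁ l ⊓ U₂ : Opens (Rn 2)) ∧
      temperedRestrict (.beurling 2) (inf_le_left : U₁ l ⊓ U₂ ≤ U₁ l) t₁ =
        temperedRestrict (.beurling 2) (inf_le_right : U₁ l ⊓ U₂ ≤ U₂) t₂ ∧
      (∃ u : Rn 2 → ℂ,
        Set.EqOn u (u₁ l) (U₁ l) ∧ Set.EqOn u u₂ U₂ ∧
        LocallyIntegrableOn u ((U₁ l ⊔ U₂ : Opens (Rn 2)) : Set (Rn 2)) ∧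
        ¬ ∃ t : Tempered (.beurling 2) (U₁ l ⊔ U₂), t.IsGivenBy u) ∧
      ¬ ∃ t : Tempered (.beurling 2) (U₁ l ⊔ U₂),
        temperedRestrict (.beurling 2) (le_sup_left : U₁ l ≤ U₁ l ⊔ U₂) t = t₁ ∧
        temperedRestrict (.beurling 2) (le_sup_right : U₂ ≤ U₁ l ⊔ U₂) t = t₂ := by
  obtain ⟨T, hT⟩ := exists_extension_expFun one_pos containedIn_beurling_two l
  have hlR : (1 : ℝ) ≤ l := by exact_mod_cast hl
  -- With τ = 1 and s = 2 the condition reads 1 < 2l + 1.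
  have hno := not_exists_gluing one_pos containedIn_beurling_two (l := l)
    (by change (1 : ℝ) < (2 * l + 1) * (2 - 1); linarith)
  refine ⟨Submodule.Quotient.mk T, Submodule.Quotient.mk 0, ?_, ?_, ?_, ?_, ?_, ?_⟩
  · rw [← expFun_one]
    exact isGivenBy_mk_iff.mpr ⟨locallyIntegrableOn_expFun one_pos l, hT⟩
  · refine isGivenBy_mk_iff.mpr ⟨?_, fun φ _ => ?_⟩
    · exact (locallyIntegrable_const (0 : ℂ)).locallyIntegrableOn _
    · simp [u₂]
  · intro z hz
    rw [← expFun_one]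
    exact expFun_eq_zero hz.2
  · refine mk_eq_mk_iff.mpr fun φ hφ => ?_
    exact (hT φ (hφ.trans inter_subset_left)).trans
      (setIntegral_expFun_eq_zero (hφ.trans inter_subset_right))
  · have hU₂ : ∀ z ∈ U₂, (U₁ l : Set (Rn 2)).indicator (expFun 1 l) z = 0 := fun z hz =>
      indicator_apply_eq_zero.mpr fun _ => expFun_eq_zero hz
    refine ⟨(U₁ l : Set (Rn 2)).indicator (expFun 1 l), fun z hz => ?_, fun z hz => hU₂ z hz,
      locallyIntegrableOn_indicator_expFun one_pos l, ?_⟩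
    · rw [indicator_of_mem hz, expFun_one]
    · rintro ⟨t, ht⟩
      obtain ⟨S, rfl⟩ := Submodule.Quotient.mk_surjective _ t
      have hS := (isGivenBy_mk_iff.mp ht).2
      -- The candidate u is `expFun` extended by zero, so its integral over the union is the
      -- integral over U₁.
      have hint : ∀ φ : Rn 2 → ℂ, ∫ x in ((U₁ l ⊔ U₂ : Opens (Rn 2)) : Set (Rn 2)),
          (U₁ l : Set (Rn 2)).indicator (expFun 1 l) x * φ x =
          ∫ x in (U₁ l : Set (Rn 2)), expFun 1 l x * φ x := by
        intro φ
        simp only [← indicator_mul_left]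
        rw [setIntegral_indicator (U₁ l).isOpen.measurableSet,
          inter_eq_right.mpr (le_sup_left : U₁ l ≤ U₁ l ⊔ U₂)]
      refine hno S (fun φ hφ => ?_) (fun φ hφ => ?_)
      · rw [hS φ ((hφ.trans inter_subset_left).trans (le_sup_left : U₁ l ≤ U₁ l ⊔ U₂)), hint]
      · rw [hS φ ((hφ.trans inter_subset_left).trans (le_sup_right : U₂ ≤ U₁ l ⊔ U₂)), hint,
          setIntegral_expFun_eq_zero (hφ.trans inter_subset_left)]
  · rintro ⟨t, ht₁, ht₂⟩
    obtain ⟨S, rfl⟩ := Submodule.Quotient.mk_surjective _ t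
    have hS₁ := mk_eq_mk_iff.mp ht₁
    have hS₂ := mk_eq_mk_iff.mp ht₂
    refine hno S (fun φ hφ => ?_) (fun φ hφ => ?_)
    · have hφ' := hφ.trans inter_subset_left
      exact (hS₁ φ hφ').trans (hT φ hφ')
    · exact hS₂ φ (hφ.trans inter_subset_left)

/-- The family of sections on the covering is defined by cases on the open set, so the two members
must differ. -/
theorem U₁_inf_ne_U₂_inf (l : ℕ) : U₁ l ⊓ unitDisc ≠ U₂ ⊓ unitDisc := by
  intro h
  have h1 : (!₂[0, 1 / 2] : Rn 2) ∈ U₁ l ⊓ unitDisc := by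
    refine ⟨?_, (mem_unitDisc_iff _).mpr (by norm_num)⟩
    change (0 : ℝ) ^ (2 * l + 1) < 1 / 2
    norm_num
  rw [h] at h1
  have h2 : (1 / 2 : ℝ) < 0 := h1.1
  norm_num at h2

theorem not_isSaSheaf_temperedPresheaf (c : GevreyClass) (hc : 1 < c.order) :
    ¬ IsSaSheaf (temperedPresheaf 2 c) := by
  intro hsheaf
  -- Any τ strictly between s - 1 and 3(s - 1) would do: the lower bound puts both classes of order
  -- s inside (τ+1), the upper one makes gluing fail for l = 1.
  have hτ : 0 < 2 * (c.order - 1) := by linarith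
  have hcont : ContainedIn c (2 * (c.order - 1) + 1) := Or.inr (by linarith)
  obtain ⟨T, hT⟩ := exists_extension_expFun hτ hcont 1
  set V := U₁ 1 ⊓ unitDisc
  set W := U₂ ⊓ unitDisc
  have hVW : V ≠ W := U₁_inf_ne_U₂_inf 1
  classical
  let R : Opens (Rn 2) → ultradistributions c (⊤ : Opens (Rn 2)) := fun Z => if Z = V then T else 0
  have hRV : R V = T := if_pos rfl
  have hRW : R W = 0 := if_neg hVW.symm
  have hoverlap : ∀ φ : testSpace c (⊤ : Opens (Rn 2)), tsupport (φ : Rn 2 → ℂ) ⊆ V →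
      tsupport (φ : Rn 2 → ℂ) ⊆ W → (T : testSpace c (⊤ : Opens (Rn 2)) →ₗ[ℂ] ℂ) φ = 0 := by
    intro φ h1 h2
    rw [hT φ (h1.trans inter_subset_left), setIntegral_expFun_eq_zero (h2.trans inter_subset_left)]
  obtain ⟨t, ht, -⟩ := hsheaf _ (isSaOpen_sup_inf 1) {V, W}
    (isSaCovering_pair (isSaOpen_U₁_inf 1) isSaOpen_U₂_inf)
    (fun Z => (Submodule.Quotient.mk (R Z) : Tempered c (Z : Opens (Rn 2)))) (by
      rintro ⟨Z, hZ⟩ ⟨Z', hZ'⟩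
      refine mk_eq_mk_iff.mpr fun φ hφ => ?_
      have hφZ := hφ.trans inter_subset_left
      have hφZ' := hφ.trans inter_subset_right
      rcases hZ with rfl | rfl <;> rcases hZ' with rfl | rfl
      · rfl
      · rw [hRV, hRW]; exact hoverlap φ hφZ hφZ'
      · rw [hRV, hRW]; exact (hoverlap φ hφZ' hφZ).symm
      · rfl)
  obtain ⟨S, rfl⟩ := Submodule.Quotient.mk_surjective _ t
  have hS₁ := mk_eq_mk_iff.mp (ht ⟨V, Or.inl rfl⟩)
  have hS₂ := mk_eq_mk_iff.mp (ht ⟨W, Or.inr rfl⟩)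
  refine not_exists_gluing hτ hcont (l := 1) ?_ S (fun φ hφ => ?_) (fun φ hφ => ?_)
  · push_cast
    linarith
  · refine (hS₁ φ hφ).trans ?_
    rw [hRV, hT φ (hφ.trans inter_subset_left)]
  · refine (hS₂ φ hφ).trans ?_
    rw [hRW]
    rfl

end TemperedUltra

open TemperedUltra in
theorem mainTheorem12 :
    (∀ l : ℕ, 1 ≤ l →
      ∃ (t₁ : Tempered (.beurling 2) (U₁ l)) (t₂ : Tempered (.beurling 2) U₂),
        t₁.IsGivenBy (u₁ l) ∧ t₂.IsGivenBy u₂ ∧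
        Set.EqOn (u₁ l) u₂ (U₁ l ⊓ U₂ : TopologicalSpace.Opens (Rn 2)) ∧
        temperedRestrict (.beurling 2) (inf_le_left : U₁ l ⊓ U₂ ≤ U₁ l) t₁ =
          temperedRestrict (.beurling 2) (inf_le_right : U₁ l ⊓ U₂ ≤ U₂) t₂ ∧
        (∃ u : Rn 2 → ℂ,
          Set.EqOn u (u₁ l) (U₁ l) ∧ Set.EqOn u u₂ U₂ ∧
          MeasureTheory.LocallyIntegrableOn u
            ((U₁ l ⊔ U₂ : TopologicalSpace.Opens (Rn 2)) : Set (Rn 2)) ∧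
          ¬ ∃ t : Tempered (.beurling 2) (U₁ l ⊔ U₂), t.IsGivenBy u) ∧
        ¬ ∃ t : Tempered (.beurling 2) (U₁ l ⊔ U₂),
          temperedRestrict (.beurling 2) (le_sup_left : U₁ l ≤ U₁ l ⊔ U₂) t = t₁ ∧
          temperedRestrict (.beurling 2) (le_sup_right : U₂ ≤ U₁ l ⊔ U₂) t = t₂) ∧
    (∀ c : GevreyClass, 1 < c.order → ¬ IsSaSheaf (temperedPresheaf 2 c)) :=
  ⟨gluing_fails_on_U₁_sup_U₂, not_isSaSheaf_temperedPresheaf⟩
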